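/- Let $d\ge 2$. For a continuous vector field $f:\mathbb T^d\to\mathbb R^d$ on the torus $\mathbb T^d=(\mathbb R/2\pi\mathbb Z)^d$ with Fourier coefficients $f_\alpha=(2\pi)^{-d}\int_{[0,2\pi]^d}e^{-i\alpha\cdot x}f(x)\,dx$, put $$\mathrm{Gen}[f](z)=\sum_{\alpha\in\mathbb Z^d}e^{z|\alpha|}\,|f_\alpha| .$$ For a vector field $f:\mathbb R^d\to\mathbb R^d$ of the form $f(x)=\int_{\mathbb R^d}e^{i\xi\cdot x}\hat f(\xi)\,d\xi$ with $\hat f\in L^1(\mathbb R^d;\mathbb C^d)$, put $$\mathrm{Gen}[f](z)=\int_{\mathbb R^d}e^{z|\xi|}\,|\hat f(\xi)|\,d\xi .$$ Here $|\cdot|$ is the Euclidean (Hermitian) norm. In either case let $X_\rho$ be the set of such $f$ with $\mathrm{Gen}[f](\rho)<\infty$. **Theorem.** Let $\Omega=\mathbb T^d$ or $\Omega=\mathbb R^d$, let $\rho>0$, and let $u_0\in X_\rho$ be a divergence-free vector field on $\Omega$. Then there are a constant $C_1>0$ (depending on $d$, $\rho$ and $u_0$) and functions $u:[0,\rho/C_1)\times\Omega\to\mathbb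 R^d$, $p:[0,\rho/C_1)\times\Omega\to\mathbb R$ such that $u,\ \partial_t u,\ \nabla u,\ \nabla p$ exist and are continuous on $[0,\rho/C_1)\times\Omega$ (with a one-sided time derivative at $t=0$), such that $$\partial_t u+u\cdot\nabla u+\nabla p=0,\qquad \nabla\cdot u=0\qquad\text{on }[0,\rho/C_1)\times\Omega,\qquad u(0,\cdot)=u_0,$$ and such that $u(t)\in X_{\rho-C_1t}$ for every $0\le t<\rho/C_1$, that is, for as long as the radius $\rho-C_1t$ is positive. -/

import Mathlib

open MeasureTheory Set
open scoped ENNReal RealInnerProductSpace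

noncomputable section

namespace EulerAnalytic

/-- Physical space (and frequency space): `ℝ^d` with the Euclidean norm. -/
abbrev E (d : ℕ) : Type := EuclideanSpace ℝ (Fin d)

/-- Complex amplitudes: `ℂ^d` with the Hermitian norm. -/
abbrev EC (d : ℕ) : Type := EuclideanSpace ℂ (Fin d)

/-- A real vector regarded as a complex vector. -/
def complexify {d : ℕ} (v : E d) : EC d := WithLp.toLp 2 (fun j => (v j : ℂ))

/-- An integer multi-index regarded as a vector of `ℝ^d`; its norm is the Euclidean `|α|`. -/
def latticeVec {d : ℕ} (α : Fin d → ℤ) : E d := WithLp.toLp 2 (fun j => (α j : ℝ))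

/-- The character `x ↦ e^{i ξ · x}`. -/
def character {d : ℕ} (ξ x : E d) : ℂ := Complex.exp (Complex.I * ((⟪ξ, x⟫ : ℝ) : ℂ))

/-- Functions on the torus `𝕋^d = (ℝ / 2πℤ)^d` are functions on `ℝ^d` that are `2π`-periodic in each
coordinate. -/
def IsTorusFunction {d : ℕ} {F : Type*} (f : E d → F) : Prop :=
  ∀ j : Fin d, Function.Periodic f (EuclideanSpace.single j (2 * Real.pi))

/-- The fundamental cell `[0, 2π]^d` of the torus. -/
def cell (d : ℕ) : Set (E d) := {x | ∀ j, x j ∈ Icc (0 : ℝ) (2 * Real.pi)}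

/-- The Fourier coefficient `f_α = (2π)^{-d} ∫_{[0,2π]^d} e^{-i α · x} f(x) dx`. -/
def torusCoeff {d : ℕ} (f : E d → E d) (α : Fin d → ℤ) : EC d :=
  ((2 * Real.pi) ^ d)⁻¹ • ∫ x in cell d, character (-latticeVec α) x • complexify (f x)

/-- The generator function on the torus, `Gen[f](z) = ∑_α e^{z|α|} |f_α|`, with value `∞` when the
series diverges. -/
def torusGen {d : ℕ} (f : E d → E d) (z : ℝ) : ℝ≥0∞ :=
  ∑' α : Fin d → ℤ, ENNReal.ofReal (Real.exp (z * ‖latticeVec α‖)) * ‖torusCoeff f α‖ₑ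

/-- The space `X_ρ` of (continuous) vector fields on the torus with `Gen[f](ρ) < ∞`. -/
def torusX (d : ℕ) (ρ : ℝ) : Set (E d → E d) :=
  {f | Continuous f ∧ IsTorusFunction f ∧ torusGen f ρ < ∞}

/-- `g` is an integrable Fourier transform of `f` on `ℝ^d`, in the normalization
`f(x) = ∫ e^{i ξ · x} g(ξ) dξ`. By injectivity of the Fourier transform on `L¹`, such a `g` is
determined by `f` up to a null set. The function `f` itself need not be integrable. -/
def IsFourierTransform {d : ℕ} (f : E d → E d) (g : E d → EC d) : Prop :=
  Integrable g ∧ ∀ x, complexify (f x) = ∫ ξ, character ξ x • g ξ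

/-- The generator function on `ℝ^d`, `Gen[f](z) = ∫ e^{z|ξ|} |f̂(ξ)| dξ`. The infimum runs over the
representatives of the (almost everywhere unique) Fourier transform, on all of which the integral
has the same value; it is `∞` if `f` has no integrable Fourier transform. -/
def spaceGen {d : ℕ} (f : E d → E d) (z : ℝ) : ℝ≥0∞ :=
  ⨅ (g : E d → EC d) (_ : IsFourierTransform f g),
    ∫⁻ ξ, ENNReal.ofReal (Real.exp (z * ‖ξ‖)) * ‖g ξ‖ₑ

/-- The space `X_ρ` of vector fields on `ℝ^d` with `Gen[f](ρ) < ∞`. -/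
def spaceX (d : ℕ) (ρ : ℝ) : Set (E d → E d) := {f | spaceGen f ρ < ∞}

/-- The divergence `∇ · v = ∑_j ∂_j v_j`. -/
def divergence {d : ℕ} (v : E d → E d) (x : E d) : ℝ :=
  ∑ j : Fin d, (fderiv ℝ v x (EuclideanSpace.single j 1)) j

/-- `(u, p)` is a classical solution on the time interval `[0, T)` of the incompressible Euler
equations `∂ₜ u + (u · ∇) u + ∇ p = 0`, `∇ · u = 0` with initial velocity `u₀`: the fields
`u`, `∇u`, `∇p` (hence also `∂ₜ u`) exist and are continuous on `[0, T) × ℝ^d`, and the equations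
hold at every point. The time derivative at `t = 0` is one-sided. -/
structure IsEulerSolution {d : ℕ} (T : ℝ) (u₀ : E d → E d) (u : ℝ → E d → E d)
    (p : ℝ → E d → ℝ) : Prop where
  initial : u 0 = u₀
  continuousOn_velocity :
    ContinuousOn (fun q : ℝ × E d => u q.1 q.2) (Ico 0 T ×ˢ univ)
  differentiable_velocity : ∀ t ∈ Ico 0 T, Differentiable ℝ (u t)
  continuousOn_fderiv_velocity :
    ContinuousOn (fun q : ℝ × E d => fderiv ℝ (u q.1) q.2) (Ico 0 T ×ˢ univ)
  differentiable_pressure : ∀ t ∈ Ico 0 T, Differentiable ℝ (p t)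
  continuousOn_gradient_pressure :
    ContinuousOn (fun q : ℝ × E d => gradient (p q.1) q.2) (Ico 0 T ×ˢ univ)
  momentum : ∀ t ∈ Ico 0 T, ∀ x,
    HasDerivWithinAt (fun s => u s x)
      (-(fderiv ℝ (u t) x (u t x)) - gradient (p t) x) (Ico 0 T) t
  incompressible : ∀ t ∈ Ico 0 T, ∀ x, divergence (u t) x = 0

end EulerAnalytic

end

noncomputable section

namespace EulerAnalytic

open Filter Topology

set_option linter.unusedSectionVars false

section FourierSymbols

variable {d : ℕ}

/-! ### Complex amplitudes and characters -/

/-! The solution is built as a power series in time, u(t) = ∑ tⁿ aₙ. In frequency space the Euler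
equations become the recursion (n+1) aₙ₊₁ = -P ∑_{i+j=n} (aᵢ·∇)aⱼ, where the Leray projection P
eliminates the pressure. The task is to sum this series in the L¹ norm with weight e^{z|ξ|},
although each step of the recursion loses a derivative.

The weight is submultiplicative, so convolution is bounded by the product of the norms
(`lintegral_exp_mul_conv_le`). Transversality of aᵢ puts the lost derivative on the output frequency
(`enorm_transportHat_le`), where a factor |ξ| costs δ⁻¹ if the radius is raised by δ
(`exp_mul_enorm_le`). The projection is a contraction (`norm_leray_le`). With δ = (ρ-z)/(n+2) the
cost δ⁻¹ is paid by the factor 1/(n+1) of the recursion, and the quadratic structure is counted by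
Catalan numbers Cₙ: `expNorm_coeff_le` bounds the norm of aₙ at radius z < ρ by M Cₙ (3M/(ρ-z))ⁿ,
hence by M (12M/(ρ-z))ⁿ.

At z = ρ - C₁t with C₁ = 48M the n-th term of the series is at most M·4⁻ⁿ, which is why the radius
may shrink linearly in time. At the fixed radius z = ρ/2 the same bound controls all coefficients
and their gradients uniformly in x, so the series may be differentiated termwise and a Cauchy
product turns the recursion into the equations (`isEulerSolution_tsum`).

Torus and whole space are treated together through an abstract group of frequencies. Only the
passage between a field and its amplitudes is specific: uniqueness of amplitudes in both cases, and
Fourier inversion on the torus. -/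

lemma complexify_apply (v : E d) (j : Fin d) : complexify v j = (v j : ℂ) := rfl

/-- `complexify` as a continuous linear map. -/
def complexifyL (d : ℕ) : E d →L[ℝ] EC d :=
  LinearMap.toContinuousLinearMap
    { toFun := complexify
      map_add' := fun v w => by ext j; simp [complexify_apply]
      map_smul' := fun c v => by ext j; simp [complexify_apply] }

@[simp] lemma complexifyL_apply (v : E d) : complexifyL d v = complexify v := rfl

/-- The componentwise real part. -/
def realPart (d : ℕ) : EC d →L[ℝ] E d :=
  LinearMap.toContinuousLinearMap
    { toFun := fun v => WithLp.toLp 2 fun j => (v j).re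
      map_add' := fun v w => by ext j; simp
      map_smul' := fun c v => by ext j; simp }

lemma realPart_apply (v : EC d) (j : Fin d) : realPart d v j = (v j).re := rfl

/-- The componentwise complex conjugation. -/
def conjL (d : ℕ) : EC d →L[ℝ] EC d :=
  LinearMap.toContinuousLinearMap
    { toFun := fun v => WithLp.toLp 2 fun j => star (v j)
      map_add' := fun v w => by ext j; simp
      map_smul' := fun c v => by ext j; simp }

lemma conjL_apply (v : EC d) (j : Fin d) : conjL d v j = star (v j) := rfl

lemma norm_complexify (v : E d) : ‖complexify v‖ = ‖v‖ := by
  simp [EuclideanSpace.norm_eq, complexify_apply]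

lemma norm_conjL (v : EC d) : ‖conjL d v‖ = ‖v‖ := by
  simp [EuclideanSpace.norm_eq, conjL_apply]

lemma norm_realPart_le (v : EC d) : ‖realPart d v‖ ≤ ‖v‖ := by
  rw [EuclideanSpace.norm_eq, EuclideanSpace.norm_eq]
  gcongr with j
  rw [realPart_apply]
  exact Complex.abs_re_le_norm _

lemma conjL_smul (c : ℂ) (v : EC d) : conjL d (c • v) = star c • conjL d v := by
  ext j; simp [conjL_apply]

lemma conjL_complexify (v : E d) : conjL d (complexify v) = complexify v := by
  ext j; simp [conjL_apply, complexify_apply]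

lemma conjL_conjL (v : EC d) : conjL d (conjL d v) = v := by
  ext j; simp [conjL_apply]

lemma complexify_realPart {v : EC d} (h : conjL d v = v) : complexify (realPart d v) = v := by
  ext j
  have := congrArg (fun w : EC d => w j) h
  simp only [conjL_apply] at this
  rw [complexify_apply, realPart_apply]
  exact Complex.conj_eq_iff_re.mp this

lemma realPart_complexify (v : E d) : realPart d (complexify v) = v := by
  ext j; simp [realPart_apply, complexify_apply]

lemma complexify_injective : Function.Injective (complexify : E d → EC d) :=
  Function.LeftInverse.injective realPart_complexify

lemma continuous_complexify : Continuous (complexify : E d → EC d) := (complexifyL d).continuous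

lemma complexify_neg (v : E d) : complexify (-v) = -complexify v := (complexifyL d).map_neg v

lemma complexify_add (v w : E d) : complexify (v + w) = complexify v + complexify w :=
  (complexifyL d).map_add v w

lemma inner_complexify (v : E d) (w : EC d) :
    inner ℂ (complexify v) w = ∑ j, (v j : ℂ) * w j := by
  simp [PiLp.inner_apply, complexify_apply, mul_comm]

lemma inner_complexify_complexify (v w : E d) :
    inner ℂ (complexify v) (complexify w) = ((⟪v, w⟫ : ℝ) : ℂ) := by
  rw [inner_complexify]
  simp [PiLp.inner_apply, complexify_apply, mul_comm]

lemma inner_complexify_conjL (v : E d) (w : EC d) :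
    inner ℂ (complexify v) (conjL d w) = star (inner ℂ (complexify v) w) := by
  simp [inner_complexify, conjL_apply]

lemma norm_character (ξ x : E d) : ‖character ξ x‖ = 1 := by
  rw [character, mul_comm, Complex.norm_exp_ofReal_mul_I]

lemma character_add (ξ η x : E d) : character (ξ + η) x = character ξ x * character η x := by
  simp only [character, inner_add_left, ← Complex.exp_add]
  congr 1; push_cast; ring

lemma character_add_right (ξ x y : E d) :
    character ξ (x + y) = character ξ x * character ξ y := by
  simp only [character, inner_add_right, ← Complex.exp_add]
  congr 1; push_cast; ring

lemma star_character (ξ x : E d) : star (character ξ x) = character (-ξ) x := by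
  simp [character, ← Complex.exp_conj]

lemma continuous_character : Continuous fun p : E d × E d => character p.1 p.2 := by
  unfold character
  fun_prop

lemma hasFDerivAt_character (ξ x : E d) :
    HasFDerivAt (fun x => character ξ x)
      ((innerSL ℝ ξ).smulRight (Complex.I * character ξ x)) x := by
  have h1 : HasFDerivAt (fun x : E d => Complex.I * ((⟪ξ, x⟫ : ℝ) : ℂ))
      (Complex.I • (Complex.ofRealCLM ∘L innerSL ℝ ξ)) x := by
    exact ((Complex.ofRealCLM ∘L innerSL ℝ ξ).hasFDerivAt (x := x)).const_mul Complex.I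
  convert! h1.cexp using 1
  ext v
  simp [character]
  ring

/-- The amplitude of the gradient of `e^{i ζ · x} w`. -/
def gradSymbol {F : Type*} [NormedAddCommGroup F] [NormedSpace ℂ F] (ζ : E d) (w : F) :
    EC d →L[ℂ] F :=
  (Complex.I • innerSL ℂ (complexify ζ)).smulRight w

section gradSymbol

variable {F : Type*} [NormedAddCommGroup F] [NormedSpace ℂ F]

lemma gradSymbol_apply (ζ : E d) (w : F) (v : EC d) :
    gradSymbol ζ w v = (Complex.I * inner ℂ (complexify ζ) v) • w := rfl

lemma norm_gradSymbol_le (ζ : E d) (w : F) : ‖gradSymbol ζ w‖ ≤ ‖ζ‖ * ‖w‖ := by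
  simp [gradSymbol, ContinuousLinearMap.norm_smulRight_apply, norm_smul, norm_complexify]

lemma continuous_gradSymbol : Continuous fun p : E d × F => gradSymbol p.1 p.2 := by
  have h : Continuous fun p : E d × F =>
      ContinuousLinearMap.smulRightL ℂ (EC d) F (Complex.I • innerSL ℂ (complexify p.1)) p.2 := by
    have := continuous_complexify (d := d)
    fun_prop
  exact h

end gradSymbol

/-- The amplitude of the pressure gradient part of a vector amplitude. -/
def pressureSymbol (ζ : E d) (w : EC d) : ℂ :=
  Complex.I * (inner ℂ (complexify ζ) w / ((‖ζ‖ ^ 2 : ℝ) : ℂ))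

/-- The projection of an amplitude onto the orthogonal complement of its frequency. -/
def leray (ζ : E d) (w : EC d) : EC d :=
  w + (Complex.I * pressureSymbol ζ w) • complexify ζ

lemma leray_eq (ζ : E d) (w : EC d) :
    leray ζ w = w - (inner ℂ (complexify ζ) w / ((‖ζ‖ ^ 2 : ℝ) : ℂ)) • complexify ζ := by
  rw [leray, pressureSymbol, ← mul_assoc, Complex.I_mul_I]
  simp [sub_eq_add_neg]

/-- This form makes orthogonality and the norm bound instances of Hilbert space facts. It needs no
case distinction: at ζ = 0 division by zero gives 0 and the span is trivial, so the mean mode is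
left unchanged. -/
lemma leray_eq_starProjection (ζ : E d) (w : EC d) :
    leray ζ w = w - (ℂ ∙ complexify ζ).starProjection w := by
  rw [leray_eq, Submodule.starProjection_singleton, norm_complexify]
  rfl

lemma inner_leray (ζ : E d) (w : EC d) : inner ℂ (complexify ζ) (leray ζ w) = 0 := by
  rw [leray_eq_starProjection]
  exact Submodule.inner_right_of_mem_orthogonal (Submodule.mem_span_singleton_self _)
    (Submodule.sub_starProjection_mem_orthogonal w)

lemma norm_leray_le (ζ : E d) (w : EC d) : ‖leray ζ w‖ ≤ ‖w‖ := by
  rw [leray_eq_starProjection, ← Submodule.starProjection_orthogonal_val]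
  exact Submodule.norm_starProjection_apply_le _ _

lemma leray_of_inner_eq_zero {ζ : E d} {w : EC d} (h : inner ℂ (complexify ζ) w = 0) :
    leray ζ w = w := by
  simp [leray_eq, h]

/-- The pressure symbol has order -1: it gains exactly the derivative that the transport term loses.
-/
lemma norm_mul_norm_pressureSymbol_le (ζ : E d) (w : EC d) :
    ‖ζ‖ * ‖pressureSymbol ζ w‖ ≤ ‖w‖ := by
  rcases eq_or_ne ζ 0 with rfl | hζ
  · simp
  have h0 : 0 < ‖ζ‖ := norm_pos_iff.mpr hζ
  have h1 : ‖inner ℂ (complexify ζ) w‖ ≤ ‖ζ‖ * ‖w‖ := by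
    simpa [norm_complexify] using norm_inner_le_norm (𝕜 := ℂ) (complexify ζ) w
  have h2 : ‖pressureSymbol ζ w‖ = ‖inner ℂ (complexify ζ) w‖ / ‖ζ‖ ^ 2 := by
    simp [pressureSymbol]
  rw [h2, mul_div_assoc', div_le_iff₀ (by positivity)]
  nlinarith

lemma pressureSymbol_conj (ζ : E d) (w : EC d) :
    pressureSymbol (-ζ) (conjL d w) = star (pressureSymbol ζ w) := by
  rw [pressureSymbol, inner_complexify_conjL, complexify_neg, inner_neg_left, pressureSymbol]
  simp only [star_neg, norm_neg, star_mul', star_div₀, RCLike.star_def, Complex.conj_I,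
    Complex.conj_ofReal]
  ring

/-- The symbol commutes with the symmetry that characterizes amplitudes of real fields, so the
recursion preserves reality. -/
lemma leray_conj (ζ : E d) (w : EC d) : leray (-ζ) (conjL d w) = conjL d (leray ζ w) := by
  rw [leray, pressureSymbol_conj, leray, map_add, conjL_smul, conjL_complexify, complexify_neg]
  simp

/-! ### Measurability of the symbols -/

lemma measurable_complexify : Measurable (complexify : E d → EC d) :=
  continuous_complexify.measurable

lemma measurable_pressureSymbol :
    Measurable fun p : E d × EC d => pressureSymbol p.1 p.2 := by
  unfold pressureSymbol
  have := measurable_complexify (d := d)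
  have h : Measurable fun p : E d × EC d => inner ℂ (complexify p.1) p.2 :=
    ((continuous_complexify.comp continuous_fst).inner continuous_snd).measurable
  have h2 : Measurable fun p : E d × EC d => (((‖p.1‖ ^ 2 : ℝ)) : ℂ) := by fun_prop
  exact (h.div h2).const_mul _

lemma measurable_leray : Measurable fun p : E d × EC d => leray p.1 p.2 := by
  unfold leray
  have h1 := measurable_pressureSymbol (d := d)
  have h2 := measurable_complexify (d := d)
  exact measurable_snd.add ((h1.const_mul _).smul (h2.comp measurable_fst))

end FourierSymbols

section FourierIntegrals

/-! ### Fourier integrals over a group of frequencies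

The frequencies form a group `Γ` with an invariant measure `ν` and a homomorphism `φ : Γ →+ ℝ^d`;
the torus is the case `Γ = ℤ^d` with the counting measure, the whole space the case `Γ = ℝ^d`. -/

/-- The function with Fourier amplitudes `a`. -/
def fourierInt {d : ℕ} {Γ : Type*} [AddCommGroup Γ] [MeasurableSpace Γ] (ν : Measure Γ)
    (φ : Γ →+ E d) {F : Type*} [NormedAddCommGroup F] [NormedSpace ℂ F] (a : Γ → F) (x : E d) : F :=
  ∫ ξ, character (φ ξ) x • a ξ ∂ν

/-- The exponentially weighted `L¹` norm of the amplitudes `a`. -/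
def expNorm {d : ℕ} {Γ : Type*} [AddCommGroup Γ] [MeasurableSpace Γ] (ν : Measure Γ)
    (φ : Γ →+ E d) {F : Type*} [NormedAddCommGroup F] (a : Γ → F) (z : ℝ) : ℝ≥0∞ :=
  ∫⁻ ξ, ENNReal.ofReal (Real.exp (z * ‖φ ξ‖)) * ‖a ξ‖ₑ ∂ν

/-- The amplitudes of the gradient. -/
def gradHat {d : ℕ} {Γ : Type*} [AddCommGroup Γ] (φ : Γ →+ E d) {F : Type*} [NormedAddCommGroup F]
    [NormedSpace ℂ F] (a : Γ → F) (ξ : Γ) : EC d →L[ℂ] F :=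
  gradSymbol (φ ξ) (a ξ)

/-- The amplitudes of the transport term `(f · ∇) g`. -/
def transportHat {d : ℕ} {Γ : Type*} [AddCommGroup Γ] [MeasurableSpace Γ] (ν : Measure Γ)
    (φ : Γ →+ E d) (f g : Γ → EC d) : Γ → EC d :=
  convolution f (gradHat φ g) (ContinuousLinearMap.apply ℂ (EC d)) ν

variable {d : ℕ} {Γ : Type*} [AddCommGroup Γ] [MeasurableSpace Γ]
  {ν : Measure Γ} {φ : Γ →+ E d}
  {F : Type*} [NormedAddCommGroup F]

lemma measurable_exp_weight (hφ : Measurable φ) (z : ℝ) :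
    Measurable fun ξ => ENNReal.ofReal (Real.exp (z * ‖φ ξ‖)) := by fun_prop

lemma measurable_character_comp (hφ : Measurable φ) (x : E d) :
    Measurable fun ξ => character (φ ξ) x :=
  (continuous_character.comp (by fun_prop : Continuous fun ξ : E d => (ξ, x))).measurable.comp hφ

lemma expNorm_mono {a : Γ → F} {z z' : ℝ} (h : z ≤ z') : expNorm ν φ a z ≤ expNorm ν φ a z' := by
  unfold expNorm
  gcongr

lemma lintegral_enorm_le_expNorm {a : Γ → F} {z : ℝ} (hz : 0 ≤ z) :
    ∫⁻ ξ, ‖a ξ‖ₑ ∂ν ≤ expNorm ν φ a z := by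
  refine le_trans (le_of_eq ?_) (expNorm_mono hz)
  simp [expNorm]

lemma integrable_of_expNorm {a : Γ → F} (ha : StronglyMeasurable a) {z : ℝ} (hz : 0 ≤ z)
    (h : expNorm ν φ a z < ∞) : Integrable a ν :=
  ⟨ha.aestronglyMeasurable, (lintegral_enorm_le_expNorm hz).trans_lt h⟩

/-- Since δs ≤ e^{δs}, a derivative can be traded for an increase δ of the radius at the price δ⁻¹.
-/
lemma mul_exp_le {s z δ : ℝ} (hδ : 0 < δ) :
    s * Real.exp (z * s) ≤ δ⁻¹ * Real.exp ((z + δ) * s) := by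
  have h : δ * s ≤ Real.exp (δ * s) := by linarith [Real.add_one_le_exp (δ * s)]
  have h2 : s ≤ δ⁻¹ * Real.exp (δ * s) := by
    rw [inv_mul_eq_div, le_div_iff₀ hδ]; linarith
  rw [add_mul, Real.exp_add]
  nlinarith [Real.exp_pos (z * s)]

lemma exp_mul_enorm_le {ζ : E d} {z δ : ℝ} (hδ : 0 < δ) :
    ENNReal.ofReal (Real.exp (z * ‖ζ‖)) * ‖ζ‖ₑ ≤
      ENNReal.ofReal δ⁻¹ * ENNReal.ofReal (Real.exp ((z + δ) * ‖ζ‖)) := by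
  rw [← ofReal_norm, ← ENNReal.ofReal_mul (by positivity), ← ENNReal.ofReal_mul (by positivity)]
  apply ENNReal.ofReal_le_ofReal
  rw [mul_comm]
  exact mul_exp_le hδ

variable [NormedSpace ℂ F]

lemma stronglyMeasurable_gradHat (hφ : Measurable φ) {a : Γ → F} (ha : StronglyMeasurable a) :
    StronglyMeasurable (gradHat φ a) :=
  (continuous_gradSymbol (d := d) (F := F)).comp_stronglyMeasurable
    (f := fun ξ => (φ ξ, a ξ)) (hφ.stronglyMeasurable.prodMk ha)

lemma expNorm_gradHat_le (a : Γ → F) (z : ℝ) {δ : ℝ} (hδ : 0 < δ) :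
    expNorm ν φ (gradHat φ a) z ≤ ENNReal.ofReal δ⁻¹ * expNorm ν φ a (z + δ) := by
  unfold expNorm
  rw [← lintegral_const_mul' _ _ ENNReal.ofReal_ne_top]
  refine lintegral_mono fun ξ => ?_
  have h : ‖gradHat φ a ξ‖ₑ ≤ ‖φ ξ‖ₑ * ‖a ξ‖ₑ := by
    rw [← ofReal_norm, ← ofReal_norm, ← ofReal_norm, ← ENNReal.ofReal_mul (norm_nonneg _)]
    exact ENNReal.ofReal_le_ofReal (norm_gradSymbol_le _ _)
  calc _ ≤ ENNReal.ofReal (Real.exp (z * ‖φ ξ‖)) * (‖φ ξ‖ₑ * ‖a ξ‖ₑ) := by gcongr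
    _ ≤ _ := by
      rw [← mul_assoc, ← mul_assoc]
      gcongr ?_ * _
      exact exp_mul_enorm_le hδ

lemma integrable_character_smul (hφ : Measurable φ) {a : Γ → F} (ha : Integrable a ν) (x : E d) :
    Integrable (fun ξ => character (φ ξ) x • a ξ) ν := by
  refine ha.mono ((measurable_character_comp hφ x).aestronglyMeasurable.smul
    ha.aestronglyMeasurable) (ae_of_all _ fun ξ => ?_)
  rw [norm_smul, norm_character, one_mul]

lemma norm_fourierInt_le {a : Γ → F} {z B : ℝ} (hz : 0 ≤ z) (hB : 0 ≤ B)
    (h : expNorm ν φ a z ≤ ENNReal.ofReal B) (x : E d) : ‖fourierInt ν φ a x‖ ≤ B := by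
  have h1 : ‖fourierInt ν φ a x‖ₑ ≤ ENNReal.ofReal B := by
    refine (enorm_integral_le_lintegral_enorm _).trans (le_trans (le_of_eq ?_)
      ((lintegral_enorm_le_expNorm hz).trans h))
    refine lintegral_congr fun ξ => ?_
    rw [← ofReal_norm, norm_smul, norm_character, one_mul, ofReal_norm]
  rw [← ofReal_norm] at h1
  exact (ENNReal.ofReal_le_ofReal_iff hB).mp h1

lemma continuous_fourierInt (hφ : Measurable φ) {a : Γ → F} (ha : Integrable a ν) :
    Continuous (fourierInt ν φ a) := by
  refine continuous_of_dominated (bound := fun ξ => ‖a ξ‖)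
    (fun x => (integrable_character_smul hφ ha x).aestronglyMeasurable)
    (fun x => ae_of_all _ fun ξ => ?_) ha.norm (ae_of_all _ fun ξ => ?_)
  · rw [norm_smul, norm_character, one_mul]
  · exact (continuous_character.comp (by fun_prop : Continuous fun x : E d => (φ ξ, x))).smul
      continuous_const

/-- Restriction of complex-linear maps to the real vectors. -/
def restrictReal (d : ℕ) (F : Type*) [NormedAddCommGroup F] [NormedSpace ℂ F] :
    (EC d →L[ℂ] F) →L[ℝ] (E d →L[ℝ] F) :=
  ((ContinuousLinearMap.compL ℝ (E d) (EC d) F).flip (complexifyL d)) ∘L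
    ContinuousLinearMap.restrictScalarsL ℂ (EC d) F ℝ ℝ

lemma restrictReal_apply (A : EC d →L[ℂ] F) (v : E d) :
    restrictReal d F A v = A (complexify v) := rfl

/-- Characters have modulus one, so the gradient amplitudes dominate the differentiated integrand
uniformly in x. -/
lemma hasFDerivAt_fourierInt [CompleteSpace F] (hφ : Measurable φ) {a : Γ → F} (ha : Integrable a ν)
    (hg : Integrable (gradHat φ a) ν) (x : E d) :
    HasFDerivAt (fourierInt ν φ a) (restrictReal d F (fourierInt ν φ (gradHat φ a) x)) x := by
  have key : restrictReal d F (fourierInt ν φ (gradHat φ a) x) =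
      ∫ ξ, restrictReal d F (character (φ ξ) x • gradHat φ a ξ) ∂ν :=
    ((restrictReal d F).integral_comp_comm (integrable_character_smul hφ hg x)).symm
  rw [key]
  refine hasFDerivAt_integral_of_dominated_of_fderiv_le (s := univ)
    (F' := fun x ξ => restrictReal d F (character (φ ξ) x • gradHat φ a ξ))
    (bound := fun ξ => ‖restrictReal d F‖ * ‖gradHat φ a ξ‖) univ_mem
    (Eventually.of_forall fun y => (integrable_character_smul hφ ha y).aestronglyMeasurable)
    (integrable_character_smul hφ ha x)
    ((restrictReal d F).integrable_comp (integrable_character_smul hφ hg x)).aestronglyMeasurable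
    (ae_of_all _ fun ξ y _ => ?_) (hg.norm.const_mul _) (ae_of_all _ fun ξ y _ => ?_)
  · refine ((restrictReal d F).le_opNorm _).trans (le_of_eq ?_)
    rw [norm_smul, norm_character, one_mul]
  · convert! (hasFDerivAt_character (φ ξ) y).smul_const (a ξ) using 1
    ext v
    simp only [restrictReal_apply, smul_apply, gradHat, gradSymbol_apply,
      inner_complexify_complexify, ContinuousLinearMap.smulRight_apply, innerSL_apply_apply,
      smul_smul, Complex.real_smul]
    congr 1; ring

lemma fourierInt_apply [CompleteSpace F] (hφ : Measurable φ) {A : Γ → EC d →L[ℂ] F}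
    (hA : Integrable A ν) (x : E d) (v : EC d) :
    fourierInt ν φ A x v = fourierInt ν φ (fun ξ => A ξ v) x := by
  unfold fourierInt
  rw [ContinuousLinearMap.integral_apply (integrable_character_smul hφ hA x)]
  rfl

lemma fourierInt_add_period {w : E d} (hw : ∀ ξ, character (φ ξ) w = 1) (a : Γ → F) (x : E d) :
    fourierInt ν φ a (x + w) = fourierInt ν φ a x := by
  simp [fourierInt, character_add_right, hw]

/-! ### Conjugation and reflection of frequencies -/

section symmetry

variable [MeasurableNeg Γ] [ν.IsNegInvariant]

lemma conjL_fourierInt (hφ : Measurable φ) {a : Γ → EC d} (ha : Integrable a ν) (x : E d) :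
    conjL d (fourierInt ν φ a x) = fourierInt ν φ (fun ξ => conjL d (a (-ξ))) x := by
  unfold fourierInt
  rw [← (conjL d).integral_comp_comm (integrable_character_smul hφ ha x), ← integral_neg_eq_self]
  refine integral_congr_ae (ae_of_all _ fun ξ => ?_)
  simp [conjL_smul, star_character, -RCLike.star_def]

lemma star_fourierInt (a : Γ → ℂ) (x : E d) :
    star (fourierInt ν φ a x) = fourierInt ν φ (fun ξ => star (a (-ξ))) x := by
  unfold fourierInt
  rw [RCLike.star_def, ← integral_conj, ← integral_neg_eq_self]
  refine integral_congr_ae (ae_of_all _ fun ξ => ?_)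
  simp only [smul_eq_mul, map_mul, map_neg, ← RCLike.star_def, star_character, neg_neg]

end symmetry

/-- The amplitudes of the pressure associated with amplitudes `w` of an acceleration. -/
def pressureHat {d : ℕ} {Γ : Type*} [AddCommGroup Γ] (φ : Γ →+ E d) (w : Γ → EC d) (ξ : Γ) : ℂ :=
  pressureSymbol (φ ξ) (w ξ)

/-- A factor |ξ| in the bound for the acceleration cancels against the order -1 of the pressure
symbol. Frequency zero is harmless because the symbol vanishes there by the convention for division
by zero. -/
lemma enorm_pressureHat_le {w : Γ → EC d} {ξ : Γ} {b : ℝ≥0∞} (h : ‖w ξ‖ₑ ≤ ‖φ ξ‖ₑ * b) :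
    ‖pressureHat φ w ξ‖ₑ ≤ b := by
  rcases eq_or_ne (φ ξ) 0 with h0 | h0
  · simp [pressureHat, pressureSymbol, h0]
  · have h1 : ‖φ ξ‖ₑ * ‖pressureHat φ w ξ‖ₑ ≤ ‖φ ξ‖ₑ * b := by
      refine le_trans ?_ h
      simp only [← ofReal_norm]
      rw [← ENNReal.ofReal_mul (norm_nonneg _)]
      exact ENNReal.ofReal_le_ofReal (norm_mul_norm_pressureSymbol_le _ _)
    exact (ENNReal.mul_le_mul_iff_right (enorm_ne_zero.mpr h0) enorm_ne_top).mp h1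

/-! ### The transport term as a convolution -/

section convolution

variable [MeasurableAdd₂ Γ] [MeasurableNeg Γ] [SFinite ν] [ν.IsAddRightInvariant]

lemma transportHat_apply (f g : Γ → EC d) (ξ : Γ) :
    transportHat ν φ f g ξ = ∫ η, gradHat φ g (ξ - η) (f η) ∂ν := rfl

lemma stronglyMeasurable_transportHat (hφ : Measurable φ) {f g : Γ → EC d}
    (hf : StronglyMeasurable f) (hg : StronglyMeasurable g) :
    StronglyMeasurable (transportHat ν φ f g) := by
  refine StronglyMeasurable.integral_prod_right (f := fun ξ η => gradHat φ g (ξ - η) (f η)) ?_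
  have h1 : StronglyMeasurable fun p : Γ × Γ => gradHat φ g (p.1 - p.2) :=
    (stronglyMeasurable_gradHat hφ hg).comp_measurable (measurable_fst.sub measurable_snd)
  have h2 : StronglyMeasurable fun p : Γ × Γ => f p.2 := hf.comp_measurable measurable_snd
  have h3 : Continuous fun p : (EC d →L[ℂ] EC d) × EC d => p.1 p.2 := by fun_prop
  exact h3.comp_stronglyMeasurable (h1.prodMk h2)

/-- The convolution theorem: the character at ξ factors into those at η and ξ - η, so weighting both
factors by characters weights their convolution by one. -/
lemma fourierInt_transportHat (hφ : Measurable φ) {f g : Γ → EC d} (hf : Integrable f ν)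
    (hg : Integrable (gradHat φ g) ν) (x : E d) :
    fourierInt ν φ (transportHat ν φ f g) x =
      fourierInt ν φ (gradHat φ g) x (fourierInt ν φ f x) := by
  have h := integral_convolution (μ := ν) (ν := ν) (ContinuousLinearMap.apply ℂ (EC d))
    (integrable_character_smul hφ hf x) (integrable_character_smul hφ hg x)
  rw [ContinuousLinearMap.apply_apply] at h
  refine Eq.trans ?_ h
  refine integral_congr_ae (ae_of_all _ fun ξ => ?_)
  simp only [transportHat, convolution, ← integral_smul]
  refine integral_congr_ae (ae_of_all _ fun η => ?_)
  have : φ ξ = φ η + φ (ξ - η) := by rw [← map_add]; congr 1; abel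
  simp only [ContinuousLinearMap.apply_apply, this, character_add, smul_apply,
    map_smul, smul_smul]
  congr 1; ring

lemma integrable_transportHat {f g : Γ → EC d} (hf : Integrable f ν)
    (hg : Integrable (gradHat φ g) ν) : Integrable (transportHat ν φ f g) ν :=
  Integrable.integrable_convolution _ hf hg

lemma transportHat_neg [ν.IsNegInvariant] {f g : Γ → EC d} (hf : ∀ ξ, f (-ξ) = conjL d (f ξ))
    (hg : ∀ ξ, g (-ξ) = conjL d (g ξ)) (ξ : Γ) :
    transportHat ν φ f g (-ξ) = conjL d (transportHat ν φ f g ξ) := by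
  -- Conjugation is an invertible continuous linear map, so it passes through the integral without
  -- any integrability assumption.
  have hL : ∀ h : Γ → EC d, conjL d (∫ η, h η ∂ν) = ∫ η, conjL d (h η) ∂ν := fun h => by
    have hh := ContinuousLinearEquiv.integral_comp_comm (μ := ν)
      (ContinuousLinearEquiv.equivOfInverse (conjL d) (conjL d) conjL_conjL conjL_conjL) h
    exact hh.symm
  rw [transportHat_apply, transportHat_apply, hL, ← integral_neg_eq_self]
  refine integral_congr_ae (ae_of_all _ fun η => ?_)
  have h1 : -ξ - -η = -(ξ - η) := by abel
  simp only [h1, gradHat, gradSymbol_apply, hf, hg, conjL_smul, map_neg, complexify_neg,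
    inner_neg_left, inner_complexify_conjL, star_mul', RCLike.star_def, Complex.conj_I]
  congr 1; ring

/-- Because η·f(η) = 0, the factor (ξ - η)·f(η) equals ξ·f(η). The derivative thus leaves the
integral as the single factor |ξ|, which the weight can absorb after the convolution and which the
pressure symbol can cancel. -/
lemma enorm_transportHat_le {f : Γ → EC d} (g : Γ → EC d)
    (hf : ∀ ξ, inner ℂ (complexify (φ ξ)) (f ξ) = 0) (ξ : Γ) :
    ‖transportHat ν φ f g ξ‖ₑ ≤ ‖φ ξ‖ₑ * ∫⁻ η, ‖f η‖ₑ * ‖g (ξ - η)‖ₑ ∂ν := by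
  rw [transportHat_apply, ← lintegral_const_mul' _ _ enorm_ne_top]
  refine (enorm_integral_le_lintegral_enorm _).trans (lintegral_mono fun η => ?_)
  have h : gradHat φ g (ξ - η) (f η) = gradSymbol (φ ξ) (g (ξ - η)) (f η) := by
    have : complexify (φ ξ) = complexify (φ (ξ - η)) + complexify (φ η) := by
      rw [← complexify_add, ← map_add, sub_add_cancel]
    rw [gradHat, gradSymbol_apply, gradSymbol_apply, this, inner_add_left, hf, add_zero]
  rw [h]
  simp only [← ofReal_norm]
  rw [← ENNReal.ofReal_mul (norm_nonneg _), ← ENNReal.ofReal_mul (norm_nonneg _)]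
  apply ENNReal.ofReal_le_ofReal
  calc _ ≤ ‖gradSymbol (φ ξ) (g (ξ - η))‖ * ‖f η‖ := ContinuousLinearMap.le_opNorm _ _
    _ ≤ ‖φ ξ‖ * ‖g (ξ - η)‖ * ‖f η‖ := by gcongr; exact norm_gradSymbol_le _ _
    _ = _ := by ring

/-- For z ≥ 0 the triangle inequality makes the weight submultiplicative. Tonelli and translation
invariance then give the algebra property of the weighted L¹ norm. -/
lemma lintegral_exp_mul_conv_le (hφ : Measurable φ) {f g : Γ → EC d} (hf : StronglyMeasurable f)
    (hg : StronglyMeasurable g) {z : ℝ} (hz : 0 ≤ z) :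
    ∫⁻ ξ, ENNReal.ofReal (Real.exp (z * ‖φ ξ‖)) * ∫⁻ η, ‖f η‖ₑ * ‖g (ξ - η)‖ₑ ∂ν ∂ν ≤
      expNorm ν φ f z * expNorm ν φ g z := by
  have hw := measurable_exp_weight hφ z
  have hfm : Measurable fun ξ => ENNReal.ofReal (Real.exp (z * ‖φ ξ‖)) * ‖f ξ‖ₑ :=
    hw.mul hf.enorm
  have hgm : Measurable fun ξ => ENNReal.ofReal (Real.exp (z * ‖φ ξ‖)) * ‖g ξ‖ₑ :=
    hw.mul hg.enorm
  calc _ ≤ ∫⁻ ξ, ∫⁻ η, (ENNReal.ofReal (Real.exp (z * ‖φ η‖)) * ‖f η‖ₑ) *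
        (ENNReal.ofReal (Real.exp (z * ‖φ (ξ - η)‖)) * ‖g (ξ - η)‖ₑ) ∂ν ∂ν := by
        refine lintegral_mono fun ξ => ?_
        rw [← lintegral_const_mul' _ _ ENNReal.ofReal_ne_top]
        refine lintegral_mono fun η => ?_
        have h : ENNReal.ofReal (Real.exp (z * ‖φ ξ‖)) ≤
            ENNReal.ofReal (Real.exp (z * ‖φ η‖)) *
              ENNReal.ofReal (Real.exp (z * ‖φ (ξ - η)‖)) := by
          rw [← ENNReal.ofReal_mul (by positivity), ← Real.exp_add, ← mul_add]
          have : φ ξ = φ η + φ (ξ - η) := by rw [← map_add]; congr 1; abel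
          gcongr
          calc ‖φ ξ‖ = ‖φ η + φ (ξ - η)‖ := by rw [← this]
            _ ≤ _ := norm_add_le _ _
        calc _ ≤ ENNReal.ofReal (Real.exp (z * ‖φ η‖)) *
              ENNReal.ofReal (Real.exp (z * ‖φ (ξ - η)‖)) * (‖f η‖ₑ * ‖g (ξ - η)‖ₑ) := by
              gcongr
          _ = _ := by ring
    _ = ∫⁻ η, ∫⁻ ξ, (ENNReal.ofReal (Real.exp (z * ‖φ η‖)) * ‖f η‖ₑ) *
        (ENNReal.ofReal (Real.exp (z * ‖φ (ξ - η)‖)) * ‖g (ξ - η)‖ₑ) ∂ν ∂ν := by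
        refine lintegral_lintegral_swap (Measurable.aemeasurable ?_)
        exact (hfm.comp measurable_snd).mul (hgm.comp (measurable_fst.sub measurable_snd))
    _ = expNorm ν φ f z * expNorm ν φ g z := by
        rw [expNorm, ← lintegral_mul_const _ hfm]
        refine lintegral_congr fun η => ?_
        have hm : Measurable fun ξ =>
            ENNReal.ofReal (Real.exp (z * ‖φ (ξ - η)‖)) * ‖g (ξ - η)‖ₑ :=
          hgm.comp (measurable_id.sub_const η)
        rw [lintegral_const_mul _ hm, lintegral_sub_right_eq_self
            (fun ξ => ENNReal.ofReal (Real.exp (z * ‖φ ξ‖)) * ‖g ξ‖ₑ) η]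
        rfl

lemma expNorm_transportHat_le (hφ : Measurable φ) {f g : Γ → EC d} (hf : StronglyMeasurable f)
    (hg : StronglyMeasurable g) (hdiv : ∀ ξ, inner ℂ (complexify (φ ξ)) (f ξ) = 0)
    {z δ : ℝ} (hz : 0 ≤ z) (hδ : 0 < δ) :
    expNorm ν φ (transportHat ν φ f g) z ≤
      ENNReal.ofReal δ⁻¹ * (expNorm ν φ f (z + δ) * expNorm ν φ g (z + δ)) := by
  refine le_trans ?_ (mul_le_mul_right (lintegral_exp_mul_conv_le hφ hf hg (by positivity)) _)
  rw [expNorm, ← lintegral_const_mul' _ _ ENNReal.ofReal_ne_top]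
  refine lintegral_mono fun ξ => ?_
  calc _ ≤ ENNReal.ofReal (Real.exp (z * ‖φ ξ‖)) *
        (‖φ ξ‖ₑ * ∫⁻ η, ‖f η‖ₑ * ‖g (ξ - η)‖ₑ ∂ν) := by
        gcongr; exact enorm_transportHat_le g hdiv ξ
    _ ≤ _ := by
        rw [← mul_assoc, ← mul_assoc]
        gcongr ?_ * _
        exact exp_mul_enorm_le hδ

end convolution

end FourierIntegrals

section TaylorCoefficients

/-! ### The Taylor coefficients in time of the solution -/

/-- The Fourier amplitudes of the Taylor coefficients in time of the solution of the Euler equations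
with initial amplitudes `a`. -/
def coeff {d : ℕ} {Γ : Type*} [AddCommGroup Γ] [MeasurableSpace Γ] (ν : Measure Γ)
    (φ : Γ →+ E d) (a : Γ → EC d) : ℕ → Γ → EC d
  | 0 => a
  | n + 1 => fun ξ => (-((n : ℂ) + 1)⁻¹) • leray (φ ξ)
      (∑ i : Fin (n + 1), transportHat ν φ (coeff ν φ a i) (coeff ν φ a (n - i)) ξ)

/-- The amplitudes of the `n`-th Taylor coefficient of the transport term. -/
def transportCoeff {d : ℕ} {Γ : Type*} [AddCommGroup Γ] [MeasurableSpace Γ] (ν : Measure Γ)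
    (φ : Γ →+ E d) (a : Γ → EC d) (n : ℕ) (ξ : Γ) : EC d :=
  ∑ ij ∈ Finset.HasAntidiagonal.antidiagonal n, transportHat ν φ (coeff ν φ a ij.1) (coeff ν φ a ij.2) ξ

/-- Amplitudes of real divergence-free vector fields. -/
structure IsAmplitude {d : ℕ} {Γ : Type*} [AddCommGroup Γ] [MeasurableSpace Γ] (φ : Γ →+ E d)
    (a : Γ → EC d) : Prop where
  stronglyMeasurable : StronglyMeasurable a
  transverse : ∀ ξ, inner ℂ (complexify (φ ξ)) (a ξ) = 0
  symm : ∀ ξ, a (-ξ) = conjL d (a ξ)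

lemma catalan_le_four_pow (n : ℕ) : (catalan n : ℝ) ≤ 4 ^ n := by
  have h1 : catalan n ≤ n.centralBinom := by
    rw [catalan_eq_centralBinom_div]; exact Nat.div_le_self _ _
  have h2 : n.centralBinom ≤ 2 ^ (2 * n) := Nat.choose_le_two_pow _ _
  have h3 : catalan n ≤ 4 ^ n := by
    rw [pow_mul] at h2; exact h1.trans h2
  exact_mod_cast h3

/-- The quantity is (1 + 1/(n+1))^{n+1} ≤ e. It is the total price of spreading the loss of radius
over n+1 steps and explains the constant 3 in the coefficient bound. -/
lemma ratio_pow_le_three (n : ℕ) : (((n : ℝ) + 2) / (n + 1)) ^ (n + 1) ≤ 3 := by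
  have h1 : ((n : ℝ) + 2) / (n + 1) ≤ Real.exp (1 / (n + 1)) := by
    refine le_trans (le_of_eq ?_) (Real.add_one_le_exp _)
    field_simp; ring
  calc _ ≤ Real.exp (1 / (n + 1)) ^ (n + 1) := by gcongr
    _ = Real.exp 1 := by
      rw [← Real.exp_nat_mul]; congr 1; push_cast; field_simp
    _ ≤ 3 := Real.exp_one_lt_three.le

variable {d : ℕ} {Γ : Type*} [AddCommGroup Γ] [MeasurableSpace Γ]
  {ν : Measure Γ} {φ : Γ →+ E d} {a : Γ → EC d}

/-- The definition sums over `Fin (n + 1)` so that the index bound is available to the termination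
check. The antidiagonal form fits both the Catalan recursion and the Cauchy product. -/
lemma coeff_succ (n : ℕ) (ξ : Γ) :
    coeff ν φ a (n + 1) ξ = (-((n : ℂ) + 1)⁻¹) • leray (φ ξ) (transportCoeff ν φ a n ξ) := by
  rw [coeff, transportCoeff, Finset.Nat.sum_antidiagonal_eq_sum_range_succ_mk,
    ← Fin.sum_univ_eq_sum_range
      (fun i => transportHat ν φ (coeff ν φ a i) (coeff ν φ a (n - i)) ξ)]

variable [MeasurableAdd₂ Γ] [MeasurableNeg Γ] [SFinite ν] [ν.IsAddRightInvariant]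

lemma stronglyMeasurable_transportCoeff_of_le (hφ : Measurable φ) {n : ℕ}
    (h : ∀ m ≤ n, StronglyMeasurable (coeff ν φ a m)) :
    StronglyMeasurable (transportCoeff ν φ a n) := by
  unfold transportCoeff
  refine Finset.stronglyMeasurable_fun_sum _ fun ij hij => ?_
  have := Finset.HasAntidiagonal.mem_antidiagonal.mp hij
  exact stronglyMeasurable_transportHat hφ (h _ (by omega)) (h _ (by omega))

lemma transportCoeff_neg_of_le [ν.IsNegInvariant] {n : ℕ}
    (h : ∀ m ≤ n, ∀ ξ, coeff ν φ a m (-ξ) = conjL d (coeff ν φ a m ξ)) (ξ : Γ) :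
    transportCoeff ν φ a n (-ξ) = conjL d (transportCoeff ν φ a n ξ) := by
  unfold transportCoeff
  rw [map_sum]
  refine Finset.sum_congr rfl fun ij hij => ?_
  have := Finset.HasAntidiagonal.mem_antidiagonal.mp hij
  exact transportHat_neg (h _ (by omega)) (h _ (by omega)) ξ

/-- The projection restores transversality at each step and commutes with the reality symmetry. Both
hold at every frequency, so no null sets have to be tracked through the convolutions. -/
lemma isAmplitude_coeff [ν.IsNegInvariant] (hφ : Measurable φ) (ha : IsAmplitude φ a) (n : ℕ) :
    IsAmplitude φ (coeff ν φ a n) := by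
  induction n using Nat.strong_induction_on with
  | _ n ih =>
  rcases n with _ | n
  · simpa only [coeff] using ha
  have ih' : ∀ m ≤ n, IsAmplitude φ (coeff ν φ a m) := fun m hm => ih m (by omega)
  have hs : coeff ν φ a (n + 1) = fun ξ => (-((n : ℂ) + 1)⁻¹) •
      leray (φ ξ) (transportCoeff ν φ a n ξ) := funext (coeff_succ n)
  refine ⟨?_, fun ξ => ?_, fun ξ => ?_⟩
  · have h1 := stronglyMeasurable_transportCoeff_of_le hφ fun m hm => (ih' m hm).stronglyMeasurable
    have h2 : Measurable fun ξ => leray (φ ξ) (transportCoeff ν φ a n ξ) :=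
      measurable_leray.comp (hφ.prodMk h1.measurable)
    rw [hs]
    exact (h2.const_smul (-((n : ℂ) + 1)⁻¹)).stronglyMeasurable
  · rw [coeff_succ, inner_smul_right, inner_leray, mul_zero]
  · rw [coeff_succ, coeff_succ, transportCoeff_neg_of_le fun m hm => (ih' m hm).symm, map_neg,
      leray_conj, conjL_smul]
    simp

/-! ### Weighted estimates for the Taylor coefficients -/

lemma expNorm_sum_le {ι : Type*} {F : Type*} [NormedAddCommGroup F] (hφ : Measurable φ)
    (s : Finset ι) {f : ι → Γ → F} (hf : ∀ i ∈ s, StronglyMeasurable (f i)) (z : ℝ) :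
    expNorm ν φ (fun ξ => ∑ i ∈ s, f i ξ) z ≤ ∑ i ∈ s, expNorm ν φ (f i) z := by
  unfold expNorm
  rw [← lintegral_finsetSum' (f := fun i ξ => ENNReal.ofReal (Real.exp (z * ‖φ ξ‖)) * ‖f i ξ‖ₑ) _
    fun i hi => ((measurable_exp_weight hφ z).mul (hf i hi).enorm).aemeasurable]
  refine lintegral_mono fun ξ => ?_
  rw [← Finset.mul_sum]
  gcongr
  exact enorm_sum_le _ _

/-- The radius is generalized in the induction: the bound for order n+1 at z uses the lower orders
at z + δ. Their powers of 3M/(ρ - z - δ) multiply to the n-th power, since i + j = n, and the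
Catalan convolution sums the rest. -/
lemma expNorm_coeff_le [ν.IsNegInvariant] (hφ : Measurable φ) (ha : IsAmplitude φ a) {ρ M : ℝ}
    (hM : 0 < M) (h0 : expNorm ν φ a ρ ≤ ENNReal.ofReal M) (n : ℕ) {z : ℝ} (hz : 0 ≤ z)
    (hzρ : z < ρ) :
    expNorm ν φ (coeff ν φ a n) z ≤
      ENNReal.ofReal (M * catalan n * (3 * M / (ρ - z)) ^ n) := by
  induction n using Nat.strong_induction_on generalizing z with
  | _ n ih =>
  rcases n with _ | n
  · simpa [coeff] using (expNorm_mono hzρ.le).trans h0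
  have hn : (0 : ℝ) < n + 1 := by positivity
  have hn2 : (0 : ℝ) < n + 2 := by positivity
  have hR : 0 < ρ - z := sub_pos.mpr hzρ
  -- With this δ the cost δ⁻¹/(n+1) is (n+2)/((n+1)(ρ-z)), bounded in n up to 1/(ρ-z), and the
  -- remaining gap ρ - z shrinks only by the factor (n+1)/(n+2).
  set δ : ℝ := (ρ - z) / (n + 2) with hδdef
  have hδ : 0 < δ := by positivity
  have hδR : ρ - (z + δ) = (ρ - z) * ((n + 1) / (n + 2)) := by
    rw [hδdef]; field_simp; ring
  have hR' : 0 < ρ - (z + δ) := by rw [hδR]; positivity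
  set q : ℝ := 3 * M / (ρ - (z + δ)) with hq
  have hq0 : 0 ≤ q := by positivity
  have hsm := fun m => (isAmplitude_coeff (ν := ν) hφ ha m).stronglyMeasurable
  have h1 : expNorm ν φ (transportCoeff ν φ a n) z ≤
      ENNReal.ofReal (δ⁻¹ * (M ^ 2 * catalan (n + 1) * q ^ n)) := by
    refine (expNorm_sum_le hφ _ (fun ij _ => stronglyMeasurable_transportHat hφ
      (hsm ij.1) (hsm ij.2)) z).trans ?_
    have h2 : ∀ ij ∈ Finset.HasAntidiagonal.antidiagonal n,
        expNorm ν φ (transportHat ν φ (coeff ν φ a ij.1) (coeff ν φ a ij.2)) z ≤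
          ENNReal.ofReal (δ⁻¹ * (M ^ 2 * (catalan ij.1 * catalan ij.2) * q ^ n)) := by
      intro ij hij
      have hij' := Finset.HasAntidiagonal.mem_antidiagonal.mp hij
      refine (expNorm_transportHat_le hφ (hsm _) (hsm _)
        (isAmplitude_coeff (ν := ν) hφ ha _).transverse hz hδ).trans ?_
      have e1 := ih ij.1 (by omega) (z := z + δ) (by positivity) (by linarith)
      have e2 := ih ij.2 (by omega) (z := z + δ) (by positivity) (by linarith)
      calc _ ≤ _ := mul_le_mul_right (mul_le_mul' e1 e2) _
        _ = _ := by
          rw [← ENNReal.ofReal_mul (by positivity), ← ENNReal.ofReal_mul (by positivity), ← hij',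
            pow_add]
          congr 1; ring
    refine (Finset.sum_le_sum h2).trans (le_of_eq ?_)
    rw [← ENNReal.ofReal_sum_of_nonneg (fun ij _ => by positivity), ← Finset.mul_sum,
      ← Finset.sum_mul, ← Finset.mul_sum, catalan_succ']
    push_cast
    rfl
  have h3 : expNorm ν φ (coeff ν φ a (n + 1)) z ≤
      ENNReal.ofReal ((n : ℝ) + 1)⁻¹ * expNorm ν φ (transportCoeff ν φ a n) z := by
    unfold expNorm
    rw [← lintegral_const_mul' _ _ ENNReal.ofReal_ne_top]
    refine lintegral_mono fun ξ => ?_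
    have h4 : ‖coeff ν φ a (n + 1) ξ‖ₑ ≤
        ENNReal.ofReal ((n : ℝ) + 1)⁻¹ * ‖transportCoeff ν φ a n ξ‖ₑ := by
      rw [coeff_succ, ← ofReal_norm, ← ofReal_norm, ← ENNReal.ofReal_mul (by positivity), norm_smul]
      apply ENNReal.ofReal_le_ofReal
      have h5 : ‖-((n : ℂ) + 1)⁻¹‖ = ((n : ℝ) + 1)⁻¹ := by
        rw [norm_neg, norm_inv]
        congr 1
        exact_mod_cast Complex.norm_natCast (n + 1)
      rw [h5]
      gcongr
      exact norm_leray_le _ _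
    calc _ ≤ _ := mul_le_mul_right h4 _
      _ = _ := by ring
  refine h3.trans ((mul_le_mul_right h1 _).trans ?_)
  rw [← ENNReal.ofReal_mul (by positivity)]
  apply ENNReal.ofReal_le_ofReal
  have hqR : q = 3 * M / (ρ - z) * ((n + 2) / (n + 1)) := by
    rw [hq, hδR]; field_simp
  -- Of the n+1 factors (n+2)/(n+1), n come from the shrunken gap in qⁿ and one from δ⁻¹/(n+1).
  have hcalc : ((n : ℝ) + 1)⁻¹ * (δ⁻¹ * (M ^ 2 * catalan (n + 1) * q ^ n)) =
      (((n : ℝ) + 2) / (n + 1)) ^ (n + 1) *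
        (M ^ 2 * catalan (n + 1) * (3 * M / (ρ - z)) ^ n / (ρ - z)) := by
    rw [hqR, mul_pow, hδdef, pow_succ (((n : ℝ) + 2) / (n + 1)) n]
    field_simp
  rw [hcalc]
  calc _ ≤ 3 * (M ^ 2 * catalan (n + 1) * (3 * M / (ρ - z)) ^ n / (ρ - z)) := by
        gcongr
        exact ratio_pow_le_three n
    _ = _ := by rw [pow_succ]; ring

lemma expNorm_coeff_le_geometric [ν.IsNegInvariant] (hφ : Measurable φ) (ha : IsAmplitude φ a)
    {ρ M : ℝ} (hM : 0 < M) (h0 : expNorm ν φ a ρ ≤ ENNReal.ofReal M) (n : ℕ) {z : ℝ} (hz : 0 ≤ z)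
    (hzρ : z < ρ) :
    expNorm ν φ (coeff ν φ a n) z ≤ ENNReal.ofReal (M * (12 * M / (ρ - z)) ^ n) := by
  have hR : 0 < ρ - z := sub_pos.mpr hzρ
  refine (expNorm_coeff_le hφ ha hM h0 n hz hzρ).trans (ENNReal.ofReal_le_ofReal ?_)
  have h1 : 12 * M / (ρ - z) = 4 * (3 * M / (ρ - z)) := by ring
  rw [h1, mul_pow, mul_assoc]
  gcongr
  exact catalan_le_four_pow n

lemma stronglyMeasurable_transportCoeff [ν.IsNegInvariant] (hφ : Measurable φ)
    (ha : IsAmplitude φ a) (n : ℕ) : StronglyMeasurable (transportCoeff ν φ a n) :=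
  stronglyMeasurable_transportCoeff_of_le hφ fun m _ =>
    (isAmplitude_coeff hφ ha m).stronglyMeasurable

lemma stronglyMeasurable_pressureHat (hφ : Measurable φ) {w : Γ → EC d}
    (hw : StronglyMeasurable w) : StronglyMeasurable (pressureHat φ w) :=
  (measurable_pressureSymbol.comp (hφ.prodMk hw.measurable)).stronglyMeasurable

lemma expNorm_le_sum_mul (hφ : Measurable φ) {ι F : Type*} [NormedAddCommGroup F] {s : Finset ι}
    {f g : ι → Γ → EC d} {w : Γ → F} (hf : ∀ i, StronglyMeasurable (f i))
    (hg : ∀ i, StronglyMeasurable (g i))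
    (h : ∀ ξ, ‖w ξ‖ₑ ≤ ∑ i ∈ s, ∫⁻ η, ‖f i η‖ₑ * ‖g i (ξ - η)‖ₑ ∂ν) {z : ℝ} (hz : 0 ≤ z) :
    expNorm ν φ w z ≤ ∑ i ∈ s, expNorm ν φ (f i) z * expNorm ν φ (g i) z := by
  have hmeas : ∀ i, Measurable fun ξ => ∫⁻ η, ‖f i η‖ₑ * ‖g i (ξ - η)‖ₑ ∂ν := fun i => by
    refine Measurable.lintegral_prod_right'
      (f := fun p : Γ × Γ => ‖f i p.2‖ₑ * ‖g i (p.1 - p.2)‖ₑ) ?_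
    exact ((hf i).enorm.comp measurable_snd).mul
      ((hg i).enorm.comp (measurable_fst.sub measurable_snd))
  have h1 : expNorm ν φ w z ≤ ∫⁻ ξ, ∑ i ∈ s, ENNReal.ofReal (Real.exp (z * ‖φ ξ‖)) *
      ∫⁻ η, ‖f i η‖ₑ * ‖g i (ξ - η)‖ₑ ∂ν ∂ν := by
    refine lintegral_mono fun ξ => ?_
    rw [← Finset.mul_sum]
    exact mul_le_mul_right (h ξ) _
  rw [lintegral_finsetSum' (f := fun i ξ => ENNReal.ofReal (Real.exp (z * ‖φ ξ‖)) *
      ∫⁻ η, ‖f i η‖ₑ * ‖g i (ξ - η)‖ₑ ∂ν) _ fun i _ =>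
    ((measurable_exp_weight hφ z).mul (hmeas i)).aemeasurable] at h1
  exact h1.trans (Finset.sum_le_sum fun i _ => lintegral_exp_mul_conv_le hφ (hf i) (hg i) hz)

lemma enorm_pressureHat_transportCoeff_le [ν.IsNegInvariant] (hφ : Measurable φ)
    (ha : IsAmplitude φ a) (n : ℕ) (ξ : Γ) :
    ‖pressureHat φ (transportCoeff ν φ a n) ξ‖ₑ ≤ ∑ ij ∈ Finset.HasAntidiagonal.antidiagonal n,
      ∫⁻ η, ‖coeff ν φ a ij.1 η‖ₑ * ‖coeff ν φ a ij.2 (ξ - η)‖ₑ ∂ν := by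
  apply enorm_pressureHat_le
  rw [Finset.mul_sum]
  refine (enorm_sum_le _ _).trans (Finset.sum_le_sum fun ij _ => ?_)
  exact enorm_transportHat_le (coeff ν φ a ij.2) (isAmplitude_coeff hφ ha ij.1).transverse ξ

/-- Since the pressure symbol cancels the lost derivative, no radius is sacrificed and the algebra
property alone suffices. The extra factor 4 comes from bounding the Catalan number of index n+1 by
4^{n+1}. -/
lemma expNorm_pressureHat_le [ν.IsNegInvariant] (hφ : Measurable φ) (ha : IsAmplitude φ a)
    {ρ M : ℝ} (hM : 0 < M) (h0 : expNorm ν φ a ρ ≤ ENNReal.ofReal M) (n : ℕ) {z : ℝ} (hz : 0 ≤ z)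
    (hzρ : z < ρ) :
    expNorm ν φ (pressureHat φ (transportCoeff ν φ a n)) z ≤
      ENNReal.ofReal (4 * M ^ 2 * (12 * M / (ρ - z)) ^ n) := by
  have hR : 0 < ρ - z := sub_pos.mpr hzρ
  have hsm := fun m => (isAmplitude_coeff (ν := ν) hφ ha m).stronglyMeasurable
  have h1 : ∀ ij ∈ Finset.HasAntidiagonal.antidiagonal n,
      expNorm ν φ (coeff ν φ a ij.1) z * expNorm ν φ (coeff ν φ a ij.2) z ≤
        ENNReal.ofReal (M ^ 2 * (catalan ij.1 * catalan ij.2) * (3 * M / (ρ - z)) ^ n) := by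
    intro ij hij
    refine (mul_le_mul' (expNorm_coeff_le hφ ha hM h0 ij.1 hz hzρ)
      (expNorm_coeff_le hφ ha hM h0 ij.2 hz hzρ)).trans (le_of_eq ?_)
    rw [← ENNReal.ofReal_mul (by positivity),
      ← Finset.HasAntidiagonal.mem_antidiagonal.mp hij, pow_add]
    congr 1; ring
  have h2 := expNorm_le_sum_mul (z := z) hφ (f := fun ij : ℕ × ℕ => coeff ν φ a ij.1)
    (g := fun ij : ℕ × ℕ => coeff ν φ a ij.2) (fun ij => hsm ij.1) (fun ij => hsm ij.2)
    (enorm_pressureHat_transportCoeff_le hφ ha n) hz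
  refine h2.trans ((Finset.sum_le_sum h1).trans ?_)
  rw [← ENNReal.ofReal_sum_of_nonneg (fun ij _ => by positivity), ← Finset.sum_mul,
    ← Finset.mul_sum]
  apply ENNReal.ofReal_le_ofReal
  have h2 : 12 * M / (ρ - z) = 4 * (3 * M / (ρ - z)) := by ring
  have h3 : ∑ ij ∈ Finset.HasAntidiagonal.antidiagonal n, (catalan ij.1 * catalan ij.2 : ℝ) =
      catalan (n + 1) := by
    rw [catalan_succ']; push_cast; rfl
  rw [h2, mul_pow, h3]
  calc M ^ 2 * catalan (n + 1) * (3 * M / (ρ - z)) ^ n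
      ≤ M ^ 2 * 4 ^ (n + 1) * (3 * M / (ρ - z)) ^ n := by
        gcongr; exact catalan_le_four_pow _
    _ = _ := by ring

end TaylorCoefficients

section PhysicalCoefficients

/-! ### The Taylor coefficients in physical space -/

/-- The Taylor coefficients in time of the velocity. -/
def velocityCoeff {d : ℕ} {Γ : Type*} [AddCommGroup Γ] [MeasurableSpace Γ] (ν : Measure Γ)
    (φ : Γ →+ E d) (a : Γ → EC d) (n : ℕ) (x : E d) : E d :=
  realPart d (fourierInt ν φ (coeff ν φ a n) x)

/-- The Taylor coefficients in time of the pressure. -/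
def pressureCoeff {d : ℕ} {Γ : Type*} [AddCommGroup Γ] [MeasurableSpace Γ] (ν : Measure Γ)
    (φ : Γ →+ E d) (a : Γ → EC d) (n : ℕ) (x : E d) : ℝ :=
  (fourierInt ν φ (pressureHat φ (transportCoeff ν φ a n)) x).re

variable {d : ℕ} {Γ : Type*} [AddCommGroup Γ] [MeasurableSpace Γ]
  {ν : Measure Γ} {φ : Γ →+ E d} {a : Γ → EC d}

section general

variable {F : Type*} [NormedAddCommGroup F] [NormedSpace ℂ F]

lemma integrable_gradHat (hφ : Measurable φ) {b : Γ → F} (hb : StronglyMeasurable b) {z : ℝ}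
    (hz : 0 < z) (h : expNorm ν φ b z < ∞) : Integrable (gradHat φ b) ν := by
  refine integrable_of_expNorm (φ := φ) (stronglyMeasurable_gradHat hφ hb) le_rfl
    ((expNorm_gradHat_le b 0 hz).trans_lt ?_)
  rw [zero_add]
  exact ENNReal.mul_lt_top ENNReal.ofReal_lt_top h

lemma norm_fourierInt_gradHat_le {b : Γ → F} {z B : ℝ} (hz : 0 < z) (hB : 0 ≤ B)
    (h : expNorm ν φ b z ≤ ENNReal.ofReal B) (x : E d) :
    ‖fourierInt ν φ (gradHat φ b) x‖ ≤ z⁻¹ * B := by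
  refine norm_fourierInt_le (φ := φ) le_rfl (by positivity) ((expNorm_gradHat_le b 0 hz).trans ?_) x
  rw [zero_add, ENNReal.ofReal_mul (by positivity)]
  gcongr

end general

/-! ### Real fields and their derivatives in terms of amplitudes -/

lemma fourierInt_coord (hφ : Measurable φ) {b : Γ → EC d} (hb : Integrable b ν) (x : E d)
    (j : Fin d) : fourierInt ν φ b x j = fourierInt ν φ (fun ξ => b ξ j) x :=
  ((EuclideanSpace.proj j : EC d →L[ℂ] ℂ).integral_comp_comm
    (integrable_character_smul hφ hb x)).symm

lemma complexify_single (j : Fin d) :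
    complexify (EuclideanSpace.single j (1 : ℝ)) = EuclideanSpace.single j (1 : ℂ) := by
  ext i
  by_cases h : i = j <;> simp [complexify_apply, h]

lemma fourierInt_eq_complexify {b : Γ → EC d} [MeasurableNeg Γ] [ν.IsNegInvariant]
    (hφ : Measurable φ) (hb : Integrable b ν) (hs : ∀ ξ, b (-ξ) = conjL d (b ξ)) (x : E d) :
    complexify (realPart d (fourierInt ν φ b x)) = fourierInt ν φ b x := by
  apply complexify_realPart
  rw [conjL_fourierInt hφ hb]
  simp only [hs, conjL_conjL]

lemma fourierInt_eq_ofReal {b : Γ → ℂ} [MeasurableNeg Γ] [ν.IsNegInvariant]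
    (hs : ∀ ξ, b (-ξ) = star (b ξ)) (x : E d) :
    (((fourierInt ν φ b x).re : ℝ) : ℂ) = fourierInt ν φ b x := by
  apply Complex.conj_eq_iff_re.mp
  rw [← RCLike.star_def, star_fourierInt]
  simp only [hs, star_star]

/-- As the real part of a Fourier integral, f is differentiable. Composing with `complexifyL` and
using uniqueness of derivatives then removes the real part. -/
lemma complexify_fderiv {f : E d → E d} {b : Γ → EC d} (hφ : Measurable φ) (hb : Integrable b ν)
    (hg : Integrable (gradHat φ b) ν) (hf : ∀ x, complexify (f x) = fourierInt ν φ b x)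
    (x v : E d) :
    complexify (fderiv ℝ f x v) = fourierInt ν φ (gradHat φ b) x (complexify v) := by
  have h1 := hasFDerivAt_fourierInt hφ hb hg x
  have hfd : HasFDerivAt f (realPart d ∘L restrictReal d (EC d)
      (fourierInt ν φ (gradHat φ b) x)) x := by
    refine ((realPart d).hasFDerivAt.comp x h1).congr_of_eventuallyEq
      (Eventually.of_forall fun y => ?_)
    simp only [Function.comp_apply, ← hf, realPart_complexify]
  have h2 : fourierInt ν φ b = complexifyL d ∘ f := funext fun y => (hf y).symm
  rw [h2] at h1
  have h3 := congrArg (fun A => A v) (((complexifyL d).hasFDerivAt.comp x hfd).unique h1)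
  rw [hfd.fderiv]
  exact h3

/-- Both directions serve: one extracts transversality from the initial field, the other shows that
the Taylor coefficients are divergence-free. -/
lemma divergence_eq_zero_iff {f : E d → E d} {b : Γ → EC d} (hφ : Measurable φ)
    (hb : Integrable b ν) (hg : Integrable (gradHat φ b) ν)
    (hf : ∀ x, complexify (f x) = fourierInt ν φ b x) (x : E d) :
    divergence f x = 0 ↔
      fourierInt ν φ (fun ξ => Complex.I * inner ℂ (complexify (φ ξ)) (b ξ)) x = 0 := by
  have key : ((divergence f x : ℝ) : ℂ) =
      fourierInt ν φ (fun ξ => Complex.I * inner ℂ (complexify (φ ξ)) (b ξ)) x := by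
    have hj : ∀ j : Fin d, ((fderiv ℝ f x (EuclideanSpace.single j 1) j : ℝ) : ℂ) =
        fourierInt ν φ (fun ξ => gradHat φ b ξ (EuclideanSpace.single j 1) j) x := by
      intro j
      rw [← complexify_apply, complexify_fderiv hφ hb hg hf, complexify_single, fourierInt_apply hφ hg]
      exact fourierInt_coord hφ (hg.apply_continuousLinearMap _) x j
    rw [divergence, Complex.ofReal_sum, Finset.sum_congr rfl fun j _ => hj j]
    unfold fourierInt
    rw [← integral_finsetSum]
    · refine integral_congr_ae (ae_of_all _ fun ξ => ?_)
      simp only [gradHat, gradSymbol_apply, inner_complexify, ← Finset.smul_sum]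
      rw [Finset.mul_sum]
      congr 1
      refine Finset.sum_congr rfl fun j _ => ?_
      simp [mul_assoc]
    · intro j _
      exact integrable_character_smul hφ
        ((EuclideanSpace.proj j : EC d →L[ℂ] ℂ).integrable_comp
          (hg.apply_continuousLinearMap _)) x
  rw [← key, Complex.ofReal_eq_zero]

variable [MeasurableAdd₂ Γ] [MeasurableNeg Γ] [SFinite ν] [ν.IsAddRightInvariant]
  [ν.IsNegInvariant]

lemma integrable_coeff (hφ : Measurable φ) (ha : IsAmplitude φ a) {ρ M : ℝ} (hρ : 0 < ρ)
    (hM : 0 < M) (h0 : expNorm ν φ a ρ ≤ ENNReal.ofReal M) (n : ℕ) :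
    Integrable (coeff ν φ a n) ν :=
  integrable_of_expNorm (isAmplitude_coeff hφ ha n).stronglyMeasurable le_rfl
    ((expNorm_coeff_le hφ ha hM h0 n le_rfl hρ).trans_lt ENNReal.ofReal_lt_top)

lemma integrable_gradHat_coeff (hφ : Measurable φ) (ha : IsAmplitude φ a) {ρ M : ℝ} (hρ : 0 < ρ)
    (hM : 0 < M) (h0 : expNorm ν φ a ρ ≤ ENNReal.ofReal M) (n : ℕ) :
    Integrable (gradHat φ (coeff ν φ a n)) ν :=
  integrable_gradHat hφ (isAmplitude_coeff hφ ha n).stronglyMeasurable (half_pos hρ)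
    ((expNorm_coeff_le hφ ha hM h0 n (half_pos hρ).le (half_lt_self hρ)).trans_lt
      ENNReal.ofReal_lt_top)

lemma complexify_velocityCoeff (hφ : Measurable φ) (ha : IsAmplitude φ a) {ρ M : ℝ} (hρ : 0 < ρ)
    (hM : 0 < M) (h0 : expNorm ν φ a ρ ≤ ENNReal.ofReal M) (n : ℕ) (x : E d) :
    complexify (velocityCoeff ν φ a n x) = fourierInt ν φ (coeff ν φ a n) x :=
  fourierInt_eq_complexify hφ (integrable_coeff hφ ha hρ hM h0 n)
    (isAmplitude_coeff hφ ha n).symm x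

lemma hasFDerivAt_velocityCoeff (hφ : Measurable φ) (ha : IsAmplitude φ a) {ρ M : ℝ} (hρ : 0 < ρ)
    (hM : 0 < M) (h0 : expNorm ν φ a ρ ≤ ENNReal.ofReal M) (n : ℕ) (x : E d) :
    HasFDerivAt (velocityCoeff ν φ a n) (realPart d ∘L restrictReal d (EC d)
      (fourierInt ν φ (gradHat φ (coeff ν φ a n)) x)) x :=
  (realPart d).hasFDerivAt.comp x (hasFDerivAt_fourierInt hφ (integrable_coeff hφ ha hρ hM h0 n)
    (integrable_gradHat_coeff hφ ha hρ hM h0 n) x)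

lemma complexify_fderiv_velocityCoeff (hφ : Measurable φ) (ha : IsAmplitude φ a) {ρ M : ℝ}
    (hρ : 0 < ρ) (hM : 0 < M) (h0 : expNorm ν φ a ρ ≤ ENNReal.ofReal M) (n : ℕ) (x v : E d) :
    complexify (fderiv ℝ (velocityCoeff ν φ a n) x v) =
      fourierInt ν φ (gradHat φ (coeff ν φ a n)) x (complexify v) :=
  complexify_fderiv hφ (integrable_coeff hφ ha hρ hM h0 n) (integrable_gradHat_coeff hφ ha hρ hM h0 n)
    (complexify_velocityCoeff hφ ha hρ hM h0 n) x v

lemma fderiv_velocityCoeff (hφ : Measurable φ) (ha : IsAmplitude φ a) {ρ M : ℝ} (hρ : 0 < ρ)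
    (hM : 0 < M) (h0 : expNorm ν φ a ρ ≤ ENNReal.ofReal M) (n : ℕ) :
    fderiv ℝ (velocityCoeff ν φ a n) = fun x => realPart d ∘L restrictReal d (EC d)
      (fourierInt ν φ (gradHat φ (coeff ν φ a n)) x) :=
  funext fun x => (hasFDerivAt_velocityCoeff hφ ha hρ hM h0 n x).fderiv

lemma continuous_fderiv_velocityCoeff (hφ : Measurable φ) (ha : IsAmplitude φ a) {ρ M : ℝ}
    (hρ : 0 < ρ) (hM : 0 < M) (h0 : expNorm ν φ a ρ ≤ ENNReal.ofReal M) (n : ℕ) :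
    Continuous (fderiv ℝ (velocityCoeff ν φ a n)) := by
  rw [fderiv_velocityCoeff hφ ha hρ hM h0 n]
  have h := continuous_fourierInt hφ (integrable_gradHat_coeff hφ ha hρ hM h0 n)
  exact continuous_const.clm_comp ((restrictReal d (EC d)).continuous.comp h)

/-- Evaluating at radius ρ/2 gives the ratio 12M/(ρ - ρ/2) = 24M/ρ. The remaining radius ρ/2 pays
for the gradient in the companion bounds, with the same ratio. -/
lemma norm_velocityCoeff_le (hφ : Measurable φ) (ha : IsAmplitude φ a) {ρ M : ℝ} (hρ : 0 < ρ)
    (hM : 0 < M) (h0 : expNorm ν φ a ρ ≤ ENNReal.ofReal M) (n : ℕ) (x : E d) :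
    ‖velocityCoeff ν φ a n x‖ ≤ M * (24 * M / ρ) ^ n := by
  refine (norm_realPart_le _).trans (norm_fourierInt_le (φ := φ) (half_pos hρ).le (by positivity)
    ?_ x)
  rw [show 24 * M / ρ = 12 * M / (ρ - ρ / 2) by field_simp; norm_num]
  exact expNorm_coeff_le_geometric hφ ha hM h0 n (half_pos hρ).le (half_lt_self hρ)

lemma norm_fderiv_velocityCoeff_le (hφ : Measurable φ) (ha : IsAmplitude φ a) {ρ M : ℝ}
    (hρ : 0 < ρ) (hM : 0 < M) (h0 : expNorm ν φ a ρ ≤ ENNReal.ofReal M) (n : ℕ) (x : E d) :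
    ‖fderiv ℝ (velocityCoeff ν φ a n) x‖ ≤ (ρ / 2)⁻¹ * (M * (24 * M / ρ) ^ n) := by
  have h1 : ‖fourierInt ν φ (gradHat φ (coeff ν φ a n)) x‖ ≤
      (ρ / 2)⁻¹ * (M * (24 * M / ρ) ^ n) := by
    refine norm_fourierInt_gradHat_le (half_pos hρ) (by positivity) ?_ x
    rw [show 24 * M / ρ = 12 * M / (ρ - ρ / 2) by field_simp; norm_num]
    exact expNorm_coeff_le_geometric hφ ha hM h0 n (half_pos hρ).le (half_lt_self hρ)
  refine le_trans ?_ h1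
  refine ContinuousLinearMap.opNorm_le_bound _ (norm_nonneg _) fun v => ?_
  rw [← norm_complexify, complexify_fderiv_velocityCoeff hφ ha hρ hM h0, ← norm_complexify v]
  exact ContinuousLinearMap.le_opNorm _ _

lemma divergence_velocityCoeff (hφ : Measurable φ) (ha : IsAmplitude φ a) {ρ M : ℝ} (hρ : 0 < ρ)
    (hM : 0 < M) (h0 : expNorm ν φ a ρ ≤ ENNReal.ofReal M) (n : ℕ) (x : E d) :
    divergence (velocityCoeff ν φ a n) x = 0 := by
  rw [divergence_eq_zero_iff hφ (integrable_coeff hφ ha hρ hM h0 n)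
    (integrable_gradHat_coeff hφ ha hρ hM h0 n) (complexify_velocityCoeff hφ ha hρ hM h0 n)]
  simp [fourierInt, (isAmplitude_coeff hφ ha n).transverse]

/-! ### Pressure coefficients and the recursion in physical space -/

lemma pressureHat_transportCoeff_neg (hφ : Measurable φ) (ha : IsAmplitude φ a) (n : ℕ) (ξ : Γ) :
    pressureHat φ (transportCoeff ν φ a n) (-ξ) =
      star (pressureHat φ (transportCoeff ν φ a n) ξ) := by
  rw [pressureHat, transportCoeff_neg_of_le fun m _ => (isAmplitude_coeff hφ ha m).symm, map_neg,
    pressureSymbol_conj]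
  rfl

lemma ofReal_pressureCoeff (hφ : Measurable φ) (ha : IsAmplitude φ a) (n : ℕ) (x : E d) :
    ((pressureCoeff ν φ a n x : ℝ) : ℂ) =
      fourierInt ν φ (pressureHat φ (transportCoeff ν φ a n)) x :=
  fourierInt_eq_ofReal (pressureHat_transportCoeff_neg hφ ha n) x

lemma integrable_pressureHat (hφ : Measurable φ) (ha : IsAmplitude φ a) {ρ M : ℝ} (hρ : 0 < ρ)
    (hM : 0 < M) (h0 : expNorm ν φ a ρ ≤ ENNReal.ofReal M) (n : ℕ) :
    Integrable (pressureHat φ (transportCoeff ν φ a n)) ν :=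
  integrable_of_expNorm
    (stronglyMeasurable_pressureHat hφ (stronglyMeasurable_transportCoeff hφ ha n)) le_rfl
    ((expNorm_pressureHat_le hφ ha hM h0 n le_rfl hρ).trans_lt ENNReal.ofReal_lt_top)

lemma integrable_gradHat_pressureHat (hφ : Measurable φ) (ha : IsAmplitude φ a) {ρ M : ℝ}
    (hρ : 0 < ρ) (hM : 0 < M) (h0 : expNorm ν φ a ρ ≤ ENNReal.ofReal M) (n : ℕ) :
    Integrable (gradHat φ (pressureHat φ (transportCoeff ν φ a n))) ν :=
  integrable_gradHat hφ
    (stronglyMeasurable_pressureHat hφ (stronglyMeasurable_transportCoeff hφ ha n)) (half_pos hρ)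
    ((expNorm_pressureHat_le hφ ha hM h0 n (half_pos hρ).le (half_lt_self hρ)).trans_lt
      ENNReal.ofReal_lt_top)

lemma hasFDerivAt_pressureCoeff (hφ : Measurable φ) (ha : IsAmplitude φ a) {ρ M : ℝ} (hρ : 0 < ρ)
    (hM : 0 < M) (h0 : expNorm ν φ a ρ ≤ ENNReal.ofReal M) (n : ℕ) (x : E d) :
    HasFDerivAt (pressureCoeff ν φ a n) (Complex.reCLM ∘L restrictReal d ℂ
      (fourierInt ν φ (gradHat φ (pressureHat φ (transportCoeff ν φ a n))) x)) x :=
  Complex.reCLM.hasFDerivAt.comp x (hasFDerivAt_fourierInt hφ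
    (integrable_pressureHat hφ ha hρ hM h0 n) (integrable_gradHat_pressureHat hφ ha hρ hM h0 n) x)

lemma ofReal_fderiv_pressureCoeff (hφ : Measurable φ) (ha : IsAmplitude φ a) {ρ M : ℝ}
    (hρ : 0 < ρ) (hM : 0 < M) (h0 : expNorm ν φ a ρ ≤ ENNReal.ofReal M) (n : ℕ) (x v : E d) :
    ((fderiv ℝ (pressureCoeff ν φ a n) x v : ℝ) : ℂ) =
      fourierInt ν φ (gradHat φ (pressureHat φ (transportCoeff ν φ a n))) x (complexify v) := by
  have h1 := hasFDerivAt_pressureCoeff hφ ha hρ hM h0 n x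
  have h2 := Complex.ofRealCLM.hasFDerivAt.comp x h1
  have h3 := hasFDerivAt_fourierInt hφ (integrable_pressureHat hφ ha hρ hM h0 n)
    (integrable_gradHat_pressureHat hφ ha hρ hM h0 n) x
  have h4 : fourierInt ν φ (pressureHat φ (transportCoeff ν φ a n)) =
      Complex.ofRealCLM ∘ pressureCoeff ν φ a n := by
    ext1 y; exact (ofReal_pressureCoeff hφ ha n y).symm
  rw [h4] at h3
  have h5 := congrArg (fun A => A v) (h2.unique h3)
  rw [h1.fderiv]
  exact h5

lemma continuous_fderiv_pressureCoeff (hφ : Measurable φ) (ha : IsAmplitude φ a) {ρ M : ℝ}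
    (hρ : 0 < ρ) (hM : 0 < M) (h0 : expNorm ν φ a ρ ≤ ENNReal.ofReal M) (n : ℕ) :
    Continuous (fderiv ℝ (pressureCoeff ν φ a n)) := by
  rw [show fderiv ℝ (pressureCoeff ν φ a n) = fun x => Complex.reCLM ∘L restrictReal d ℂ
      (fourierInt ν φ (gradHat φ (pressureHat φ (transportCoeff ν φ a n))) x) from
    funext fun x => (hasFDerivAt_pressureCoeff hφ ha hρ hM h0 n x).fderiv]
  have h := continuous_fourierInt hφ (integrable_gradHat_pressureHat hφ ha hρ hM h0 n)
  exact continuous_const.clm_comp ((restrictReal d ℂ).continuous.comp h)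

lemma expNorm_pressureHat_half_le (hφ : Measurable φ) (ha : IsAmplitude φ a) {ρ M : ℝ}
    (hρ : 0 < ρ) (hM : 0 < M) (h0 : expNorm ν φ a ρ ≤ ENNReal.ofReal M) (n : ℕ) :
    expNorm ν φ (pressureHat φ (transportCoeff ν φ a n)) (ρ / 2) ≤
      ENNReal.ofReal (4 * M ^ 2 * (24 * M / ρ) ^ n) := by
  rw [show 24 * M / ρ = 12 * M / (ρ - ρ / 2) by field_simp; norm_num]
  exact expNorm_pressureHat_le hφ ha hM h0 n (half_pos hρ).le (half_lt_self hρ)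

lemma norm_pressureCoeff_le (hφ : Measurable φ) (ha : IsAmplitude φ a) {ρ M : ℝ} (hρ : 0 < ρ)
    (hM : 0 < M) (h0 : expNorm ν φ a ρ ≤ ENNReal.ofReal M) (n : ℕ) (x : E d) :
    ‖pressureCoeff ν φ a n x‖ ≤ 4 * M ^ 2 * (24 * M / ρ) ^ n :=
  (Complex.abs_re_le_norm _).trans (norm_fourierInt_le (φ := φ) (half_pos hρ).le (by positivity)
    (expNorm_pressureHat_half_le hφ ha hρ hM h0 n) x)

lemma norm_fderiv_pressureCoeff_le (hφ : Measurable φ) (ha : IsAmplitude φ a) {ρ M : ℝ}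
    (hρ : 0 < ρ) (hM : 0 < M) (h0 : expNorm ν φ a ρ ≤ ENNReal.ofReal M) (n : ℕ) (x : E d) :
    ‖fderiv ℝ (pressureCoeff ν φ a n) x‖ ≤ (ρ / 2)⁻¹ * (4 * M ^ 2 * (24 * M / ρ) ^ n) := by
  refine le_trans ?_ (norm_fourierInt_gradHat_le (half_pos hρ) (by positivity)
    (expNorm_pressureHat_half_le hφ ha hρ hM h0 n) x)
  refine ContinuousLinearMap.opNorm_le_bound _ (norm_nonneg _) fun v => ?_
  rw [← Complex.norm_real, ofReal_fderiv_pressureCoeff hφ ha hρ hM h0, ← norm_complexify v]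
  exact ContinuousLinearMap.le_opNorm _ _

lemma integrable_transportCoeff (hφ : Measurable φ) (ha : IsAmplitude φ a) {ρ M : ℝ} (hρ : 0 < ρ)
    (hM : 0 < M) (h0 : expNorm ν φ a ρ ≤ ENNReal.ofReal M) (n : ℕ) :
    Integrable (transportCoeff ν φ a n) ν := by
  unfold transportCoeff
  exact integrable_finsetSum _ fun ij _ => integrable_transportHat
    (integrable_coeff hφ ha hρ hM h0 ij.1) (integrable_gradHat_coeff hφ ha hρ hM h0 ij.2)

lemma fourierInt_transportCoeff (hφ : Measurable φ) (ha : IsAmplitude φ a) {ρ M : ℝ} (hρ : 0 < ρ)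
    (hM : 0 < M) (h0 : expNorm ν φ a ρ ≤ ENNReal.ofReal M) (n : ℕ) (x : E d) :
    fourierInt ν φ (transportCoeff ν φ a n) x =
      complexify (∑ ij ∈ Finset.HasAntidiagonal.antidiagonal n,
        fderiv ℝ (velocityCoeff ν φ a ij.2) x (velocityCoeff ν φ a ij.1 x)) := by
  rw [← complexifyL_apply, map_sum]
  have h1 : ∀ ij ∈ Finset.HasAntidiagonal.antidiagonal n,
      complexifyL d (fderiv ℝ (velocityCoeff ν φ a ij.2) x (velocityCoeff ν φ a ij.1 x)) =
        fourierInt ν φ (transportHat ν φ (coeff ν φ a ij.1) (coeff ν φ a ij.2)) x := by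
    intro ij _
    rw [complexifyL_apply, complexify_fderiv_velocityCoeff hφ ha hρ hM h0,
      complexify_velocityCoeff hφ ha hρ hM h0, fourierInt_transportHat hφ
      (integrable_coeff hφ ha hρ hM h0 ij.1) (integrable_gradHat_coeff hφ ha hρ hM h0 ij.2)]
  rw [Finset.sum_congr rfl h1]
  unfold fourierInt
  rw [← integral_finsetSum]
  · simp only [transportCoeff, Finset.smul_sum]
  · intro ij _
    exact integrable_character_smul hφ (integrable_transportHat
      (integrable_coeff hφ ha hρ hM h0 ij.1) (integrable_gradHat_coeff hφ ha hρ hM h0 ij.2)) x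

/-- The pressure force is, up to sign, the part of the transport term removed by an orthogonal
projection, so it is dominated by that term. -/
lemma integrable_pressure_force (hφ : Measurable φ) (ha : IsAmplitude φ a) {ρ M : ℝ} (hρ : 0 < ρ)
    (hM : 0 < M) (h0 : expNorm ν φ a ρ ≤ ENNReal.ofReal M) (n : ℕ) :
    Integrable (fun ξ => (Complex.I * pressureHat φ (transportCoeff ν φ a n) ξ) •
      complexify (φ ξ)) ν := by
  refine (integrable_transportCoeff hφ ha hρ hM h0 n).mono ?_ (ae_of_all _ fun ξ => ?_)
  · exact (((stronglyMeasurable_pressureHat hφ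
      (stronglyMeasurable_transportCoeff hφ ha n)).measurable.const_mul _).smul
      (measurable_complexify.comp hφ)).aestronglyMeasurable
  · rw [norm_smul, norm_mul, Complex.norm_I, one_mul, norm_complexify, mul_comm]
    exact norm_mul_norm_pressureSymbol_le _ _

lemma fourierInt_pressure_force (hφ : Measurable φ) (ha : IsAmplitude φ a) {ρ M : ℝ} (hρ : 0 < ρ)
    (hM : 0 < M) (h0 : expNorm ν φ a ρ ≤ ENNReal.ofReal M) (n : ℕ) (x : E d) :
    fourierInt ν φ (fun ξ => (Complex.I * pressureHat φ (transportCoeff ν φ a n) ξ) •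
      complexify (φ ξ)) x = complexify (gradient (pressureCoeff ν φ a n) x) := by
  ext j
  have h1 : gradient (pressureCoeff ν φ a n) x j =
      fderiv ℝ (pressureCoeff ν φ a n) x (EuclideanSpace.single j 1) := by
    rw [← InnerProductSpace.toDual_symm_apply (𝕜 := ℝ), ← gradient,
      EuclideanSpace.inner_single_right]
    simp
  rw [fourierInt_coord hφ (integrable_pressure_force hφ ha hρ hM h0 n), complexify_apply, h1,
    ofReal_fderiv_pressureCoeff hφ ha hρ hM h0,
    fourierInt_apply hφ (integrable_gradHat_pressureHat hφ ha hρ hM h0 n)]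
  congr 1
  ext1 ξ
  simp only [gradHat, gradSymbol_apply, inner_complexify_complexify,
    EuclideanSpace.inner_single_right]
  simp [complexify_apply]
  ring

/-- The projection was defined as the identity plus the amplitude of a pressure gradient, so
inverting the transform yields the Euler recursion with its pressure. -/
lemma velocityCoeff_succ (hφ : Measurable φ) (ha : IsAmplitude φ a) {ρ M : ℝ} (hρ : 0 < ρ)
    (hM : 0 < M) (h0 : expNorm ν φ a ρ ≤ ENNReal.ofReal M) (n : ℕ) (x : E d) :
    ((n : ℝ) + 1) • velocityCoeff ν φ a (n + 1) x =
      -(∑ ij ∈ Finset.HasAntidiagonal.antidiagonal n,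
        fderiv ℝ (velocityCoeff ν φ a ij.2) x (velocityCoeff ν φ a ij.1 x)) -
      gradient (pressureCoeff ν φ a n) x := by
  apply complexify_injective
  rw [← complexifyL_apply, ← complexifyL_apply, map_smul, map_sub, map_neg]
  simp only [complexifyL_apply]
  rw [complexify_velocityCoeff hφ ha hρ hM h0, ← fourierInt_transportCoeff hφ ha hρ hM h0,
    ← fourierInt_pressure_force hφ ha hρ hM h0]
  unfold fourierInt
  rw [← integral_neg, ← integral_sub, ← integral_smul]
  · refine integral_congr_ae (ae_of_all _ fun ξ => ?_)
    have hn : ((n : ℂ) + 1) ≠ 0 := by exact_mod_cast Nat.succ_ne_zero n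
    simp only [coeff_succ, leray]
    rw [← Complex.coe_smul, smul_smul, smul_smul]
    push_cast
    rw [show ((n : ℂ) + 1) * character (φ ξ) x * -((n : ℂ) + 1)⁻¹ = -character (φ ξ) x by
      field_simp]
    rw [smul_add, neg_smul, neg_smul, sub_eq_add_neg]
    rfl
  · exact (integrable_character_smul hφ (integrable_transportCoeff hφ ha hρ hM h0 n) x).neg
  · exact integrable_character_smul hφ (integrable_pressure_force hφ ha hρ hM h0 n) x

end PhysicalCoefficients

section TimeSeries

/-! ### Power series in time -/

section powerSeries

variable {F G : Type*} [NormedAddCommGroup F] [NormedSpace ℝ F] [CompleteSpace F]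
  [NormedAddCommGroup G] [NormedSpace ℝ G] [CompleteSpace G] {B r T t : ℝ}

lemma norm_pow_smul_le {v : F} {n : ℕ} (ht : |t| ≤ T) (hv : ‖v‖ ≤ B * r ^ n) :
    ‖t ^ n • v‖ ≤ B * (r * T) ^ n := by
  rw [norm_smul, norm_pow, Real.norm_eq_abs, mul_pow]
  have h1 : |t| ^ n ≤ T ^ n := by gcongr
  calc |t| ^ n * ‖v‖ ≤ T ^ n * (B * r ^ n) :=
        mul_le_mul h1 hv (norm_nonneg _) (pow_nonneg ((abs_nonneg t).trans ht) n)
    _ = _ := by ring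

lemma summable_bound (hr : 0 ≤ r) (hT : 0 ≤ T) (hrT : r * T < 1) :
    Summable fun n => B * (r * T) ^ n :=
  (summable_geometric_of_lt_one (by positivity) hrT).mul_left B

lemma summable_norm_pow_smul (hr : 0 ≤ r) (hT : 0 ≤ T) (hrT : r * T < 1) {v : ℕ → F}
    (hv : ∀ n, ‖v n‖ ≤ B * r ^ n) (ht : |t| ≤ T) : Summable fun n => ‖t ^ n • v n‖ :=
  Summable.of_nonneg_of_le (fun _ => norm_nonneg _) (fun n => norm_pow_smul_le ht (hv n))
    (summable_bound hr hT hrT)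

lemma summable_pow_smul (hr : 0 ≤ r) (hT : 0 ≤ T) (hrT : r * T < 1) {v : ℕ → F}
    (hv : ∀ n, ‖v n‖ ≤ B * r ^ n) (ht : |t| ≤ T) : Summable fun n => t ^ n • v n :=
  (summable_norm_pow_smul hr hT hrT hv ht).of_norm

lemma hasFDerivAt_tsum_pow_smul {d : ℕ} (hr : 0 ≤ r) (hT : 0 ≤ T) (hrT : r * T < 1) {B' : ℝ}
    {V : ℕ → E d → F} (hV : ∀ n, Differentiable ℝ (V n)) (hVb : ∀ n x, ‖V n x‖ ≤ B * r ^ n)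
    (hVb' : ∀ n x, ‖fderiv ℝ (V n) x‖ ≤ B' * r ^ n) (ht : |t| ≤ T) (x : E d) :
    HasFDerivAt (fun x => ∑' n, t ^ n • V n x) (∑' n, t ^ n • fderiv ℝ (V n) x) x :=
  hasFDerivAt_tsum (summable_bound (B := B') hr hT hrT)
    (fun n y => ((hV n y).hasFDerivAt).const_smul (t ^ n))
    (fun n y => norm_pow_smul_le ht (hVb' n y))
    (summable_pow_smul hr hT hrT (fun n => hVb n x) ht) x

lemma continuousOn_tsum_pow_smul {d : ℕ} (hr : 0 ≤ r) (hT : 0 ≤ T) (hrT : r * T < 1)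
    {W : ℕ → E d → F} (hW : ∀ n, Continuous (W n)) (hWb : ∀ n x, ‖W n x‖ ≤ B * r ^ n) :
    ContinuousOn (fun q : ℝ × E d => ∑' n, q.1 ^ n • W n q.2) (Ico 0 T ×ˢ univ) := by
  refine continuousOn_tsum (fun n => ?_) (summable_bound (B := B) hr hT hrT) fun n q hq =>
    norm_pow_smul_le (abs_le.mpr ⟨by linarith [hq.1.1], hq.1.2.le⟩) (hWb n q.2)
  have := hW n
  fun_prop

lemma hasDerivAt_tsum_pow_smul (hr : 0 ≤ r) (hT : 0 < T) (hrT : r * T < 1) {v : ℕ → F}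
    (hv : ∀ n, ‖v n‖ ≤ B * r ^ n) (ht : |t| < T) :
    HasDerivAt (fun s => ∑' n, s ^ n • v n) (∑' n : ℕ, t ^ n • (((n : ℝ) + 1) • v (n + 1))) t := by
  -- The derived term is at most n·Tⁿ⁻¹·B·rⁿ, which is this majorant. For n = 0 the truncated
  -- exponent n - 1 does not matter, because the factor n vanishes.
  have hu : Summable fun n : ℕ => B / T * ((n : ℝ) ^ 1 * (r * T) ^ n) := by
    have h : ‖r * T‖ < 1 := by rwa [Real.norm_of_nonneg (by positivity)]
    exact (summable_pow_mul_geometric_of_norm_lt_one (R := ℝ) 1 h).mul_left (B / T)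
  have hbound : ∀ (n : ℕ), ∀ s ∈ Ioo (-T) T,
      ‖((n : ℝ) * s ^ (n - 1)) • v n‖ ≤ B / T * ((n : ℝ) ^ 1 * (r * T) ^ n) := by
    intro n s hs
    rcases n with _ | n
    · simp
    have hs' : |s| ≤ T := (abs_lt.mpr hs).le
    have h1 : |s| ^ n ≤ T ^ n := by gcongr
    rw [norm_smul, norm_mul, norm_pow, Real.norm_eq_abs s, Real.norm_natCast, Nat.add_sub_cancel]
    calc ((n + 1 : ℕ) : ℝ) * |s| ^ n * ‖v (n + 1)‖
        ≤ ((n + 1 : ℕ) : ℝ) * T ^ n * (B * r ^ (n + 1)) := by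
          gcongr
          exact hv (n + 1)
      _ = _ := by rw [mul_pow, pow_succ T n]; field_simp
  have htm : t ∈ Ioo (-T) T := abs_lt.mp ht
  have h := hasDerivAt_tsum_of_isPreconnected (g := fun (n : ℕ) (s : ℝ) => s ^ n • v n)
    (g' := fun n s => ((n : ℝ) * s ^ (n - 1)) • v n) hu isOpen_Ioo isPreconnected_Ioo
    (fun n s _ => (hasDerivAt_pow n s).smul_const (v n)) hbound htm
    (summable_pow_smul hr hT.le hrT hv ht.le) htm
  convert! h using 1
  have hs : Summable fun n : ℕ => ((n : ℝ) * t ^ (n - 1)) • v n :=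
    Summable.of_norm_bounded hu fun n => hbound n t htm
  rw [hs.tsum_eq_zero_add]
  simp only [Nat.cast_zero, zero_mul, zero_smul, zero_add, Nat.add_sub_cancel, smul_smul]
  refine tsum_congr fun n => ?_
  push_cast
  rw [mul_comm]

/-- A Cauchy product for operators applied to vectors: the double series converges absolutely and is
regrouped along antidiagonals. -/
lemma hasSum_sum_antidiagonal_apply {A : ℕ → F →L[ℝ] G} {v : ℕ → F} (hA : Summable fun n => ‖A n‖)
    (hv : Summable fun n => ‖v n‖) :
    HasSum (fun n => ∑ ij ∈ Finset.HasAntidiagonal.antidiagonal n, A ij.2 (v ij.1))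
      ((∑' n, A n) (∑' n, v n)) := by
  have hs : Summable fun ij : ℕ × ℕ => A ij.2 (v ij.1) := by
    refine Summable.of_norm_bounded
      (hv.mul_of_nonneg hA (fun _ => norm_nonneg _) fun _ => norm_nonneg _) fun ij => ?_
    rw [mul_comm]
    exact (A ij.2).le_opNorm _
  have h1 : ∑' ij : ℕ × ℕ, A ij.2 (v ij.1) = (∑' n, A n) (∑' n, v n) := by
    rw [hs.tsum_prod, (∑' n, A n).map_tsum hv.of_norm]
    refine tsum_congr fun i => ?_
    exact ((ContinuousLinearMap.apply ℝ G (v i)).map_tsum hA.of_norm).symm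
  rw [← h1]
  have hs' := Finset.HasAntidiagonal.sigmaAntidiagonalEquivProd.hasSum_iff.mpr hs.hasSum
  refine hs'.sigma fun n => ?_
  rw [← Finset.sum_finset_coe]
  exact hasSum_fintype _

end powerSeries

lemma divergence_eq_clm {d : ℕ} (f : E d → E d) (x : E d) :
    divergence f x = (∑ j : Fin d, (EuclideanSpace.proj j : E d →L[ℝ] ℝ) ∘L
      ContinuousLinearMap.apply ℝ (E d) (EuclideanSpace.single j (1 : ℝ))) (fderiv ℝ f x) := by
  simp [divergence]

/-- A power series in time whose coefficients satisfy the recursion of the Euler equations is a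
solution. -/
theorem isEulerSolution_tsum {d : ℕ} {V : ℕ → E d → E d} {Q : ℕ → E d → ℝ}
    {B₁ B₂ B₃ B₄ r T : ℝ} (hr : 0 ≤ r) (hT : 0 < T) (hrT : r * T < 1)
    (hV : ∀ n, Differentiable ℝ (V n)) (hV' : ∀ n, Continuous (fderiv ℝ (V n)))
    (hVb : ∀ n x, ‖V n x‖ ≤ B₁ * r ^ n) (hVb' : ∀ n x, ‖fderiv ℝ (V n) x‖ ≤ B₂ * r ^ n)
    (hQ : ∀ n, Differentiable ℝ (Q n)) (hQ' : ∀ n, Continuous (fderiv ℝ (Q n)))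
    (hQb : ∀ n x, ‖Q n x‖ ≤ B₃ * r ^ n) (hQb' : ∀ n x, ‖fderiv ℝ (Q n) x‖ ≤ B₄ * r ^ n)
    (hdiv : ∀ n x, divergence (V n) x = 0)
    (hrec : ∀ (n : ℕ) x, ((n : ℝ) + 1) • V (n + 1) x =
      -(∑ ij ∈ Finset.HasAntidiagonal.antidiagonal n, fderiv ℝ (V ij.2) x (V ij.1 x)) -
        gradient (Q n) x) :
    IsEulerSolution T (V 0) (fun t x => ∑' n, t ^ n • V n x) (fun t x => ∑' n, t ^ n • Q n x) := by
  have habs : ∀ t ∈ Ico 0 T, |t| < T := fun t ht => abs_lt.mpr ⟨by linarith [ht.1], ht.2⟩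
  have hVd : ∀ t ∈ Ico 0 T, ∀ x, HasFDerivAt (fun x => ∑' n, t ^ n • V n x)
      (∑' n, t ^ n • fderiv ℝ (V n) x) x := fun t ht x =>
    hasFDerivAt_tsum_pow_smul hr hT.le hrT hV hVb hVb' (habs t ht).le x
  have hQd : ∀ t ∈ Ico 0 T, ∀ x, HasFDerivAt (fun x => ∑' n, t ^ n • Q n x)
      (∑' n, t ^ n • fderiv ℝ (Q n) x) x := fun t ht x =>
    hasFDerivAt_tsum_pow_smul hr hT.le hrT hQ hQb hQb' (habs t ht).le x
  refine ⟨?_, ?_, fun t ht x => (hVd t ht x).differentiableAt, ?_,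
    fun t ht x => (hQd t ht x).differentiableAt, ?_, fun t ht x => ?_, fun t ht x => ?_⟩
  · ext1 x
    rw [tsum_eq_single 0 fun n hn => by simp [hn]]
    simp
  · exact continuousOn_tsum_pow_smul hr hT.le hrT (fun n => (hV n).continuous) hVb
  · refine (continuousOn_tsum_pow_smul hr hT.le hrT hV' hVb').congr fun q hq => ?_
    exact (hVd q.1 hq.1 q.2).fderiv
  · refine ((InnerProductSpace.toDual ℝ (E d)).symm.continuous.comp_continuousOn
      (continuousOn_tsum_pow_smul hr hT.le hrT hQ' hQb')).congr fun q hq => ?_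
    simp only [gradient, (hQd q.1 hq.1 q.2).fderiv, Function.comp_apply]
  -- The series converges on both sides of t = 0, so even the initial time derivative is obtained as
  -- a two-sided one.
  · refine HasDerivAt.hasDerivWithinAt ?_
    convert! hasDerivAt_tsum_pow_smul hr hT hrT (fun n => hVb n x) (habs t ht) using 1
    simp only [hrec, gradient]
    rw [(hVd t ht x).fderiv, (hQd t ht x).fderiv]
    have hs1 := summable_norm_pow_smul hr hT.le hrT (fun n => hVb n x) (habs t ht).le
    have hs2 := summable_norm_pow_smul hr hT.le hrT (fun n => hVb' n x) (habs t ht).le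
    have hs3 := summable_pow_smul hr hT.le hrT (fun n => hQb' n x) (habs t ht).le
    have hanti : ∀ n, ∑ ij ∈ Finset.HasAntidiagonal.antidiagonal n,
        (t ^ ij.2 • fderiv ℝ (V ij.2) x) (t ^ ij.1 • V ij.1 x) =
        t ^ n • ∑ ij ∈ Finset.HasAntidiagonal.antidiagonal n,
          fderiv ℝ (V ij.2) x (V ij.1 x) := by
      intro n
      rw [Finset.smul_sum]
      refine Finset.sum_congr rfl fun ij hij => ?_
      rw [smul_apply, map_smul, smul_smul, ← pow_add,
        add_comm, Finset.HasAntidiagonal.mem_antidiagonal.mp hij]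
    have hs4 := hasSum_sum_antidiagonal_apply hs2 hs1
    simp only [hanti] at hs4
    have hs5 := hs3.hasSum.map (InnerProductSpace.toDual ℝ (E d)).symm
      (InnerProductSpace.toDual ℝ (E d)).symm.continuous
    refine Eq.trans ?_ (hs4.neg.sub hs5).tsum_eq.symm |>.trans (tsum_congr fun n => ?_)
    · rfl
    · rw [smul_sub, smul_neg, Function.comp_apply, map_smulₛₗ]
      rfl
  · rw [divergence_eq_clm, (hVd t ht x).fderiv, ContinuousLinearMap.map_tsum _
      (summable_pow_smul hr hT.le hrT (fun n => hVb' n x) (habs t ht).le)]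
    simp only [map_smul, ← divergence_eq_clm, hdiv, smul_zero, tsum_zero]

end TimeSeries

section Amplitudes

/-! ### Solutions from amplitudes -/

variable {d : ℕ} {Γ : Type*} [AddCommGroup Γ] [MeasurableSpace Γ]
  {ν : Measure Γ} {φ : Γ →+ E d} [MeasurableNeg Γ] [ν.IsNegInvariant]

/-- A real divergence-free vector field has transverse Hermitian amplitudes, if amplitudes are
unique. -/
lemma exists_isAmplitude (hφ : Measurable φ)
    (hinj : ∀ h : Γ → ℂ, Integrable h ν → (∀ x, fourierInt ν φ h x = 0) → h =ᵐ[ν] 0)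
    {f : E d → E d} {g : Γ → EC d} (hg : Integrable g ν)
    (hf : ∀ x, complexify (f x) = fourierInt ν φ g x) (hdiv : ∀ x, divergence f x = 0)
    {ρ : ℝ} (hρ : 0 < ρ) (hgen : expNorm ν φ g ρ < ∞) :
    ∃ a, IsAmplitude φ a ∧ expNorm ν φ a ρ < ∞ ∧ ∀ x, complexify (f x) = fourierInt ν φ a x := by
  -- The conditions on amplitudes are imposed at every frequency, so an almost everywhere class has
  -- to be replaced by a suitable representative.
  set g₁ := hg.1.mk g with hg₁
  have hg₁s : StronglyMeasurable g₁ := hg.1.stronglyMeasurable_mk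
  have hae : g =ᵐ[ν] g₁ := hg.1.ae_eq_mk
  have hg₁i : Integrable g₁ ν := hg.congr hae
  have hf₁ : ∀ x, complexify (f x) = fourierInt ν φ g₁ x := fun x => by
    rw [hf]
    refine integral_congr_ae ?_
    filter_upwards [hae] with ξ hξ
    rw [hξ]
  have hgen₁ : expNorm ν φ g₁ ρ < ∞ := by
    refine lt_of_eq_of_lt (lintegral_congr_ae ?_) hgen
    filter_upwards [hae] with ξ hξ
    rw [hξ]
  -- As f is real, the reflected conjugate represents f as well. The average of the two is Hermitian
  -- everywhere and does so too.
  set g₂ : Γ → EC d := fun ξ => (2 : ℂ)⁻¹ • (g₁ ξ + conjL d (g₁ (-ξ))) with hg₂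
  have hrs : StronglyMeasurable fun ξ => conjL d (g₁ (-ξ)) :=
    (conjL d).continuous.comp_stronglyMeasurable (hg₁s.comp_measurable measurable_neg)
  have hri : Integrable (fun ξ => conjL d (g₁ (-ξ))) ν := (conjL d).integrable_comp hg₁i.comp_neg
  have hg₂s : StronglyMeasurable g₂ := (hg₁s.add hrs).const_smul (2 : ℂ)⁻¹
  have hg₂i : Integrable g₂ ν := (hg₁i.add hri).smul (2 : ℂ)⁻¹
  have hf₂ : ∀ x, complexify (f x) = fourierInt ν φ g₂ x := fun x => by
    have h1 : fourierInt ν φ g₂ x = (2 : ℂ)⁻¹ • (fourierInt ν φ g₁ x +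
        fourierInt ν φ (fun ξ => conjL d (g₁ (-ξ))) x) := by
      unfold fourierInt
      rw [← integral_add (integrable_character_smul hφ hg₁i x)
        (integrable_character_smul hφ hri x), ← integral_smul]
      refine integral_congr_ae (ae_of_all _ fun ξ => ?_)
      simp only [hg₂, smul_add, smul_comm (2 : ℂ)⁻¹]
    rw [h1, ← conjL_fourierInt hφ hg₁i, ← hf₁, conjL_complexify, ← two_smul ℂ, smul_smul]
    norm_num
  have hgen₂ : expNorm ν φ g₂ ρ < ∞ := by
    have h1 : expNorm ν φ (fun ξ => conjL d (g₁ (-ξ))) ρ = expNorm ν φ g₁ ρ := by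
      rw [expNorm, ← lintegral_neg_eq_self]
      refine lintegral_congr fun ξ => ?_
      rw [neg_neg, map_neg, norm_neg, ← ofReal_norm, norm_conjL, ofReal_norm]
    have h2 : expNorm ν φ g₂ ρ ≤ expNorm ν φ g₁ ρ +
        expNorm ν φ (fun ξ => conjL d (g₁ (-ξ))) ρ := by
      unfold expNorm
      have hm : Measurable fun ξ => ENNReal.ofReal (Real.exp (ρ * ‖φ ξ‖)) * ‖g₁ ξ‖ₑ :=
        (measurable_exp_weight hφ ρ).mul hg₁s.enorm
      rw [← lintegral_add_left hm]
      refine lintegral_mono fun ξ => ?_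
      rw [← mul_add]
      gcongr
      have h3 : ‖(2 : ℂ)⁻¹‖ₑ ≤ 1 := by
        rw [← ofReal_norm]
        norm_num
      calc ‖g₂ ξ‖ₑ ≤ 1 * ‖g₁ ξ + conjL d (g₁ (-ξ))‖ₑ := by
            rw [hg₂, enorm_smul]; gcongr
        _ ≤ _ := by rw [one_mul]; exact enorm_add_le _ _
    refine h2.trans_lt ?_
    rw [h1]
    exact ENNReal.add_lt_top.mpr ⟨hgen₁, hgen₁⟩
  have hsym₂ : ∀ ξ, g₂ (-ξ) = conjL d (g₂ ξ) := fun ξ => by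
    simp only [hg₂, neg_neg, conjL_smul, map_add, conjL_conjL]
    rw [add_comm]
    simp
  have hgrad₂ : Integrable (gradHat φ g₂) ν :=
    integrable_gradHat hφ hg₂s hρ hgen₂
  have hdivint : Integrable (fun ξ => Complex.I * inner ℂ (complexify (φ ξ)) (g₂ ξ)) ν := by
    have hm : Measurable fun ξ => inner ℂ (complexify (φ ξ)) (g₂ ξ) :=
      (measurable_complexify.comp hφ).inner hg₂s.measurable
    refine Integrable.mono' (g := fun ξ => ‖φ ξ‖ * ‖g₂ ξ‖) ?_
      (hm.const_mul _).aestronglyMeasurable (ae_of_all _ fun ξ => ?_)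
    · refine integrable_of_expNorm (φ := φ) (z := 0)
        (hφ.norm.stronglyMeasurable.mul hg₂s.norm) le_rfl ?_
      refine lt_of_le_of_lt ?_
        (ENNReal.mul_lt_top (ENNReal.ofReal_lt_top (r := ρ⁻¹)) hgen₂)
      unfold expNorm
      rw [← lintegral_const_mul' _ _ ENNReal.ofReal_ne_top]
      refine lintegral_mono fun ξ => ?_
      rw [enorm_mul, enorm_norm, enorm_norm, ← mul_assoc, ← mul_assoc]
      gcongr ?_ * _
      simpa using exp_mul_enorm_le (ζ := φ ξ) (z := 0) hρ
    · rw [norm_mul, Complex.norm_I, one_mul, ← norm_complexify]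
      exact norm_inner_le_norm _ _
  have hzero := hinj _ hdivint fun x =>
    (divergence_eq_zero_iff hφ hg₂i hgrad₂ hf₂ x).mp (hdiv x)
  have hae₂ : ∀ᵐ ξ ∂ν, leray (φ ξ) (g₂ ξ) = g₂ ξ := by
    filter_upwards [hzero] with ξ hξ
    exact leray_of_inner_eq_zero (by simpa using hξ)
  -- Projecting makes the amplitudes transverse at every frequency; by uniqueness it alters them
  -- only on a null set.
  refine ⟨fun ξ => leray (φ ξ) (g₂ ξ), ⟨?_, fun ξ => inner_leray _ _, fun ξ => ?_⟩, ?_, fun x => ?_⟩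
  · exact (measurable_leray.comp (hφ.prodMk hg₂s.measurable)).stronglyMeasurable
  · simp only [hsym₂, map_neg, leray_conj]
  · refine lt_of_eq_of_lt (lintegral_congr_ae ?_) hgen₂
    filter_upwards [hae₂] with ξ hξ
    rw [hξ]
  · rw [hf₂]
    refine integral_congr_ae ?_
    filter_upwards [hae₂] with ξ hξ
    rw [hξ]

/-! ### Series of amplitudes -/

section series

variable {F : Type*} [NormedAddCommGroup F] [NormedSpace ℂ F] [CompleteSpace F]

/-- The series of amplitudes need converge only almost everywhere, namely where the sum of the norms
is finite, so measurability is obtained only up to null sets. -/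
lemma aestronglyMeasurable_tsum {c : ℕ → Γ → F} (hc : ∀ n, StronglyMeasurable (c n))
    (h : ∑' n, ∫⁻ ξ, ‖c n ξ‖ₑ ∂ν ≠ ∞) : AEStronglyMeasurable (fun ξ => ∑' n, c n ξ) ν := by
  rw [← lintegral_tsum fun n => (hc n).enorm.aemeasurable] at h
  refine aestronglyMeasurable_of_tendsto_ae atTop
    (f := fun (N : ℕ) ξ => ∑ n ∈ Finset.range N, c n ξ)
    (fun N => (Finset.stronglyMeasurable_fun_sum _ fun n _ => hc n).aestronglyMeasurable) ?_
  filter_upwards [ae_lt_top (Measurable.tsum fun n => (hc n).enorm) h] with ξ hξ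
  exact (tsum_enorm_ne_top_iff_summable_norm.mp hξ.ne).of_norm.hasSum.tendsto_sum_nat

lemma expNorm_tsum_le (hφ : Measurable φ) {c : ℕ → Γ → F} (hc : ∀ n, StronglyMeasurable (c n))
    (z : ℝ) : expNorm ν φ (fun ξ => ∑' n, c n ξ) z ≤ ∑' n, expNorm ν φ (c n) z := by
  unfold expNorm
  rw [← lintegral_tsum (f := fun n ξ => ENNReal.ofReal (Real.exp (z * ‖φ ξ‖)) * ‖c n ξ‖ₑ)
    fun n => ((measurable_exp_weight hφ z).mul (hc n).enorm).aemeasurable]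
  refine lintegral_mono fun ξ => ?_
  rw [ENNReal.tsum_mul_left]
  gcongr
  exact enorm_tsum_le_tsum_enorm

lemma fourierInt_tsum (hφ : Measurable φ) {c : ℕ → Γ → F} (hc : ∀ n, StronglyMeasurable (c n))
    (h : ∑' n, ∫⁻ ξ, ‖c n ξ‖ₑ ∂ν ≠ ∞) (x : E d) :
    fourierInt ν φ (fun ξ => ∑' n, c n ξ) x = ∑' n, fourierInt ν φ (c n) x := by
  unfold fourierInt
  rw [← integral_tsum (f := fun n ξ => character (φ ξ) x • c n ξ) (fun n => ((measurable_character_comp hφ x).stronglyMeasurable.smul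
    (hc n)).aestronglyMeasurable)]
  · refine integral_congr_ae (ae_of_all _ fun ξ => ?_)
    have h0 : character (φ ξ) x ≠ 0 := by
      rw [← norm_ne_zero_iff, norm_character]; exact one_ne_zero
    exact (tsum_const_smul'' _).symm
  · convert! h using 5 with n ξ
    rw [← ofReal_norm, norm_smul, norm_character, one_mul, ofReal_norm]

end series

variable [MeasurableAdd₂ Γ] [SFinite ν] [ν.IsAddRightInvariant]

/-- Existence of analytic solutions on `[0, ρ / C₁)` for transverse Hermitian initial amplitudes. -/
theorem exists_isEulerSolution (hφ : Measurable φ) {a : Γ → EC d} (ha : IsAmplitude φ a)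
    {u₀ : E d → E d} (hu₀ : ∀ x, complexify (u₀ x) = fourierInt ν φ a x) {ρ : ℝ} (hρ : 0 < ρ)
    (hgen : expNorm ν φ a ρ < ∞) :
    ∃ C₁ : ℝ, 0 < C₁ ∧ ∃ (u : ℝ → E d → E d) (p : ℝ → E d → ℝ),
      IsEulerSolution (ρ / C₁) u₀ u p ∧
      (∀ t ∈ Ico 0 (ρ / C₁), ∃ b : Γ → EC d, Integrable b ν ∧
        expNorm ν φ b (ρ - C₁ * t) < ∞ ∧ ∀ x, complexify (u t x) = fourierInt ν φ b x) ∧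
      ∀ w, (∀ ξ, character (φ ξ) w = 1) →
        ∀ t x, u t (x + w) = u t x ∧ p t (x + w) = p t x := by
  -- The summand 1 keeps M positive when the initial field vanishes.
  set M : ℝ := (expNorm ν φ a ρ).toReal + 1 with hMdef
  have hM : 0 < M := by positivity
  have h0 : expNorm ν φ a ρ ≤ ENNReal.ofReal M := by
    rw [← ENNReal.ofReal_toReal hgen.ne]
    exact ENNReal.ofReal_le_ofReal (by rw [hMdef]; linarith)
  have hV0 : velocityCoeff ν φ a 0 = u₀ := by
    ext1 x
    rw [velocityCoeff, coeff, ← hu₀, realPart_complexify]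
  -- With C₁ = 48M the lifespan is T = ρ/(48M), so the ratio 24M/ρ of the physical bounds satisfies
  -- (24M/ρ)·T = 1/2.
  refine ⟨48 * M, by positivity, fun t x => ∑' n, t ^ n • velocityCoeff ν φ a n x,
    fun t x => ∑' n, t ^ n • pressureCoeff ν φ a n x, ?_, fun t ht => ?_, fun w hw t x => ?_⟩
  · rw [← hV0]
    refine isEulerSolution_tsum (r := 24 * M / ρ) (B₁ := M) (B₂ := (ρ / 2)⁻¹ * M) (B₃ := 4 * M ^ 2)
      (B₄ := (ρ / 2)⁻¹ * (4 * M ^ 2)) (by positivity) (by positivity) ?_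
      (fun n x => (hasFDerivAt_velocityCoeff hφ ha hρ hM h0 n x).differentiableAt)
      (continuous_fderiv_velocityCoeff hφ ha hρ hM h0)
      (norm_velocityCoeff_le hφ ha hρ hM h0) (fun n x => ?_)
      (fun n x => (hasFDerivAt_pressureCoeff hφ ha hρ hM h0 n x).differentiableAt)
      (continuous_fderiv_pressureCoeff hφ ha hρ hM h0)
      (norm_pressureCoeff_le hφ ha hρ hM h0) (fun n x => ?_)
      (divergence_velocityCoeff hφ ha hρ hM h0) (velocityCoeff_succ hφ ha hρ hM h0)
    · have : 24 * M / ρ * (ρ / (48 * M)) = 1 / 2 := by field_simp; norm_num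
      rw [this]; norm_num
    · exact (norm_fderiv_velocityCoeff_le hφ ha hρ hM h0 n x).trans (le_of_eq (by ring))
    · exact (norm_fderiv_pressureCoeff_le hφ ha hρ hM h0 n x).trans (le_of_eq (by ring))
  · have hz : 0 < ρ - 48 * M * t := by
      have := ht.2
      rw [lt_div_iff₀ (by positivity)] at this
      linarith
    set c : ℕ → Γ → EC d := fun n ξ => t ^ n • coeff ν φ a n ξ with hc
    have hcs : ∀ n, StronglyMeasurable (c n) := fun n =>
      (isAmplitude_coeff hφ ha n).stronglyMeasurable.const_smul (t ^ n)
    -- The gap to ρ is 48Mt, so for t > 0 the ratio is t·12M/(48Mt) = 1/4, independent of t.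
    have hcb : ∀ n, expNorm ν φ (c n) (ρ - 48 * M * t) ≤ ENNReal.ofReal (M * (1 / 4) ^ n) := by
      intro n
      have hcn : expNorm ν φ (c n) (ρ - 48 * M * t) =
          ENNReal.ofReal (t ^ n) * expNorm ν φ (coeff ν φ a n) (ρ - 48 * M * t) := by
        unfold expNorm
        rw [← lintegral_const_mul' _ _ ENNReal.ofReal_ne_top]
        refine lintegral_congr fun ξ => ?_
        rw [hc, enorm_smul, Real.enorm_of_nonneg (pow_nonneg ht.1 n)]
        ring
      rw [hcn]
      -- At t = 0 the radius is ρ itself, outside the range of the coefficient bound, but only the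
      -- zeroth term survives.
      rcases ht.1.eq_or_lt with h | h
      · rcases n with _ | n
        · simpa [← h, coeff] using h0
        · simp [← h]
      · refine (mul_le_mul_right (expNorm_coeff_le_geometric hφ ha hM h0 n hz.le
          (by nlinarith)) _).trans (le_of_eq ?_)
        rw [← ENNReal.ofReal_mul (pow_nonneg ht.1 n)]
        congr 1
        rw [sub_sub_cancel, mul_left_comm, ← mul_pow]
        congr 2
        field_simp
        norm_num
    have hsum : ∑' n, expNorm ν φ (c n) (ρ - 48 * M * t) < ∞ := by
      refine (ENNReal.tsum_le_tsum hcb).trans_lt ?_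
      rw [← ENNReal.ofReal_tsum_of_nonneg (fun n => by positivity)
        ((summable_geometric_of_lt_one (by norm_num) (by norm_num)).mul_left M)]
      exact ENNReal.ofReal_lt_top
    have hsum0 : ∑' n, ∫⁻ ξ, ‖c n ξ‖ₑ ∂ν ≠ ∞ :=
      ((ENNReal.tsum_le_tsum fun n => lintegral_enorm_le_expNorm hz.le).trans_lt hsum).ne
    have hbgen := (expNorm_tsum_le hφ hcs (ρ - 48 * M * t)).trans_lt hsum
    refine ⟨fun ξ => ∑' n, c n ξ, ⟨aestronglyMeasurable_tsum hcs hsum0,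
      (lintegral_enorm_le_expNorm hz.le).trans_lt hbgen⟩, hbgen, fun x => ?_⟩
    rw [fourierInt_tsum hφ hcs hsum0, ← complexifyL_apply, ContinuousLinearMap.map_tsum]
    · refine tsum_congr fun n => ?_
      rw [map_smul, complexifyL_apply, complexify_velocityCoeff hφ ha hρ hM h0]
      unfold fourierInt
      rw [← integral_smul]
      refine integral_congr_ae (ae_of_all _ fun ξ => ?_)
      simp only [hc, smul_comm (t ^ n)]
    · refine summable_pow_smul (r := 24 * M / ρ) (T := ρ / (48 * M)) (by positivity) (by positivity)
        ?_ (fun n => norm_velocityCoeff_le hφ ha hρ hM h0 n x) ?_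
      · have : 24 * M / ρ * (ρ / (48 * M)) = 1 / 2 := by field_simp; norm_num
        rw [this]; norm_num
      · rw [abs_of_nonneg ht.1]; exact ht.2.le
  · simp only [velocityCoeff, pressureCoeff, fourierInt_add_period hw, and_self]

end Amplitudes

section WholeSpace

/-! ### The whole space -/

open scoped FourierTransform SchwartzMap ContDiff in
-- Injectivity of the Fourier transform on L¹ by duality: every test function is the transform of a
-- Schwartz function K, and moving the transform from K to h gives zero.
lemma ae_eq_zero_of_fourierInt_eq_zero {d : ℕ} {h : E d → ℂ} (hh : Integrable h)
    (h0 : ∀ x, fourierInt volume (AddMonoidHom.id (E d)) h x = 0) : h =ᵐ[volume] 0 := by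
  have hF : ∀ w, 𝓕 h w = 0 := by
    intro w
    rw [Real.fourier_eq', ← h0 ((-(2 * Real.pi)) • w)]
    refine integral_congr_ae (ae_of_all _ fun v => ?_)
    simp only [character, AddMonoidHom.id_apply, inner_smul_right]
    congr 2
    push_cast
    ring
  refine ae_eq_zero_of_integral_contDiff_smul_eq_zero hh.locallyIntegrable fun g hg hgs => ?_
  have hG : HasCompactSupport fun x => (g x : ℂ) := hgs.comp_left Complex.ofReal_zero
  have hG' : ContDiff ℝ ∞ fun x => (g x : ℂ) := Complex.ofRealCLM.contDiff.comp hg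
  set G : 𝓢(E d, ℂ) := hG.toSchwartzMap hG'
  set K : 𝓢(E d, ℂ) := 𝓕⁻ G with hK
  have h1 : ∫ ξ, 𝓕 h ξ • K ξ = ∫ x, h x • 𝓕 (⇑K) x := by
    simpa using! VectorFourier.integral_fourierIntegral_smul_eq_flip (L := innerₗ (E d))
      Real.continuous_fourierChar continuous_inner hh K.integrable
  have h2 : ∀ x, 𝓕 (⇑K) x = (g x : ℂ) := fun x => by
    rw [← SchwartzMap.fourier_coe, hK, FourierTransform.fourier_fourierInv_eq]
    rfl
  simp only [hF, zero_smul, integral_zero, h2] at h1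
  rw [h1]
  refine integral_congr_ae (ae_of_all _ fun x => ?_)
  simp [mul_comm]

/-- Local existence of analytic solutions on the whole space. -/
theorem exists_isEulerSolution_space {d : ℕ} {ρ : ℝ} (hρ : 0 < ρ) {u₀ : E d → E d}
    (hdiv : ∀ x, divergence u₀ x = 0) (hu₀ : u₀ ∈ spaceX d ρ) :
    ∃ C₁ : ℝ, 0 < C₁ ∧ ∃ (u : ℝ → E d → E d) (p : ℝ → E d → ℝ),
      IsEulerSolution (ρ / C₁) u₀ u p ∧
      ∀ t ∈ Ico 0 (ρ / C₁), u t ∈ spaceX d (ρ - C₁ * t) := by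
  obtain ⟨g, hg⟩ := iInf_lt_iff.mp (show spaceGen u₀ ρ < ∞ from hu₀)
  obtain ⟨hgF, hgen⟩ := iInf_lt_iff.mp hg
  have hφ : Measurable (AddMonoidHom.id (E d)) := measurable_id
  obtain ⟨a, ha, hagen, hau⟩ := exists_isAmplitude (ν := volume) hφ
    (fun h hh h0 => ae_eq_zero_of_fourierInt_eq_zero hh h0) hgF.1 hgF.2 hdiv hρ hgen
  obtain ⟨C₁, hC₁, u, p, hsol, hreg, -⟩ := exists_isEulerSolution hφ ha hau hρ hagen
  refine ⟨C₁, hC₁, u, p, hsol, fun t ht => ?_⟩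
  obtain ⟨b, hb, hbgen, hbu⟩ := hreg t ht
  have hbF : IsFourierTransform (u t) b := ⟨hb, hbu⟩
  -- The infimum only has to be bounded by one representative, so uniqueness of the transform plays
  -- no role here.
  have hle : spaceGen (u t) (ρ - C₁ * t) ≤ expNorm volume (AddMonoidHom.id (E d)) b (ρ - C₁ * t) :=
    iInf₂_le b hbF
  exact hle.trans_lt hbgen

end WholeSpace

section Torus

/-! ### The torus -/

variable {d : ℕ}

/-- `latticeVec` as a homomorphism. -/
def latticeHom (d : ℕ) : (Fin d → ℤ) →+ E d where
  toFun := latticeVec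
  map_zero' := by ext j; simp [latticeVec]
  map_add' α β := by ext j; simp [latticeVec]

lemma latticeHom_apply (α : Fin d → ℤ) : latticeHom d α = latticeVec α := rfl

lemma character_latticeVec (α : Fin d → ℤ) (x : E d) :
    character (latticeVec α) x = ∏ j, Complex.exp (Complex.I * α j * x j) := by
  rw [character, ← Complex.exp_sum, PiLp.inner_apply, Complex.ofReal_sum, Finset.mul_sum]
  congr 1
  refine Finset.sum_congr rfl fun j _ => ?_
  simp [latticeVec]
  ring

lemma character_latticeVec_period (α : Fin d → ℤ) (j : Fin d) :
    character (latticeVec α) (EuclideanSpace.single j (2 * Real.pi)) = 1 := by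
  rw [character, EuclideanSpace.inner_single_right, Complex.exp_eq_one_iff]
  refine ⟨α j, ?_⟩
  simp [latticeVec]
  ring

lemma setIntegral_cell {F : Type*} [NormedAddCommGroup F] [NormedSpace ℝ F] (H : E d → F) :
    ∫ x in cell d, H x =
      ∫ y in univ.pi fun _ : Fin d => Icc (0 : ℝ) (2 * Real.pi), H (WithLp.toLp 2 y) := by
  rw [← (PiLp.volume_preserving_toLp (Fin d)).setIntegral_preimage_emb
    (MeasurableEquiv.toLp 2 (Fin d → ℝ)).measurableEmbedding]
  congr 2
  ext y
  simp only [cell, mem_preimage, Set.mem_ofPred_eq, Set.mem_pi, mem_univ, forall_const]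

lemma integral_exp_int (n : ℤ) :
    ∫ x in Icc (0 : ℝ) (2 * Real.pi), Complex.exp (Complex.I * n * x) =
      if n = 0 then (2 * Real.pi : ℂ) else 0 := by
  rw [integral_Icc_eq_integral_Ioc, ← intervalIntegral.integral_of_le Real.two_pi_pos.le]
  split_ifs with h
  · simp [h]
  · rw [integral_exp_mul_complex (mul_ne_zero Complex.I_ne_zero (Int.cast_ne_zero.mpr h))]
    have : Complex.exp (Complex.I * n * ((2 * Real.pi : ℝ) : ℂ)) = 1 := by
      rw [Complex.exp_eq_one_iff]
      exact ⟨n, by push_cast; ring⟩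
    rw [this]
    simp

lemma setIntegral_cell_character (α : Fin d → ℤ) :
    ∫ x in cell d, character (latticeVec α) x = if α = 0 then ((2 * Real.pi) ^ d : ℂ) else 0 := by
  rw [setIntegral_cell, volume_pi, Measure.restrict_pi_pi]
  simp only [character_latticeVec]
  rw [integral_fintype_prod_eq_prod (fun (j : Fin d) (x : ℝ) => Complex.exp (Complex.I * α j * x))]
  simp only [integral_exp_int]
  split_ifs with h
  · simp [h]
  · obtain ⟨j, hj⟩ := Function.ne_iff.mp h
    exact Finset.prod_eq_zero (Finset.mem_univ j) (if_neg hj)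

lemma isCompact_cell (d : ℕ) : IsCompact (cell d) := by
  have h : cell d = (EuclideanSpace.equiv (Fin d) ℝ).symm ''
      (univ.pi fun _ : Fin d => Icc (0 : ℝ) (2 * Real.pi)) := by
    ext x
    simp only [cell, Set.mem_ofPred_eq, mem_image, Set.mem_pi, mem_univ, forall_const]
    exact ⟨fun hx => ⟨EuclideanSpace.equiv (Fin d) ℝ x, hx, by simp⟩,
      by rintro ⟨y, hy, rfl⟩; exact hy⟩
  rw [h]
  exact (isCompact_univ_pi fun _ => isCompact_Icc).image (ContinuousLinearEquiv.continuous _)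

/-- The amplitudes of an absolutely convergent Fourier series are its Fourier coefficients. -/
lemma setIntegral_cell_fourierInt {F : Type*} [NormedAddCommGroup F] [NormedSpace ℂ F]
    [CompleteSpace F] {b : (Fin d → ℤ) → F} (hb : Integrable b Measure.count) (α : Fin d → ℤ) :
    ((2 * Real.pi) ^ d)⁻¹ • ∫ x in cell d, character (-latticeVec α) x •
      fourierInt Measure.count (latticeHom d) b x = b α := by
  have : IsFiniteMeasure ((volume : Measure (E d)).restrict (cell d)) :=
    ⟨by rw [Measure.restrict_apply_univ]; exact (isCompact_cell d).measure_lt_top⟩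
  have hchar : ∀ β x, character (-latticeVec α) x * character (latticeVec β) x =
      character (latticeVec (β - α)) x := fun β x => by
    rw [← character_add, ← latticeHom_apply, ← latticeHom_apply, ← latticeHom_apply, map_sub]
    congr 1; abel
  have h1 : ∀ x, character (-latticeVec α) x • fourierInt Measure.count (latticeHom d) b x =
      ∫ β, character (latticeVec (β - α)) x • b β ∂Measure.count := fun x => by
    rw [fourierInt, ← integral_smul]
    refine integral_congr_ae (ae_of_all _ fun β => ?_)
    simp only [smul_smul, latticeHom_apply, hchar]
  have hcm : Measurable fun p : E d × (Fin d → ℤ) => character (latticeVec (p.2 - α)) p.1 := by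
    have h2 : Measurable fun p : E d × (Fin d → ℤ) => (latticeVec (p.2 - α), p.1) :=
      ((measurable_of_countable fun β : Fin d → ℤ => latticeVec (β - α)).comp
        measurable_snd).prodMk measurable_fst
    have h3 : Measurable fun p : E d × E d => character p.1 p.2 := continuous_character.measurable
    have h4 := h3.comp h2
    simpa only [Function.comp_def] using h4
  -- Finite measure of the cell together with absolute summability of b justifies exchanging sum and
  -- integral; orthogonality of characters then isolates the term α.
  have hint : Integrable (Function.uncurry fun (x : E d) (β : Fin d → ℤ) =>
      character (latticeVec (β - α)) x • b β)
      (((volume : Measure (E d)).restrict (cell d)).prod Measure.count) := by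
    have hb2 : Integrable (fun p : E d × (Fin d → ℤ) => b p.2)
        (((volume : Measure (E d)).restrict (cell d)).prod Measure.count) := hb.comp_snd _
    have hm : AEStronglyMeasurable (fun p : E d × (Fin d → ℤ) =>
        character (latticeVec (p.2 - α)) p.1 • b p.2)
        (((volume : Measure (E d)).restrict (cell d)).prod Measure.count) :=
      hcm.aestronglyMeasurable.smul hb2.aestronglyMeasurable
    refine hb2.mono hm (ae_of_all _ fun p => ?_)
    simp only [Function.uncurry]
    rw [norm_smul, norm_character, one_mul]
  simp only [h1]
  rw [integral_integral_swap hint]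
  have h3 : ∀ β, ∫ x in cell d, character (latticeVec (β - α)) x • b β =
      if β = α then ((2 * Real.pi) ^ d : ℂ) • b β else 0 := fun β => by
    rw [integral_smul_const, setIntegral_cell_character]
    simp only [sub_eq_zero]
    split_ifs <;> simp
  simp only [h3]
  have h4 : Integrable (fun β => if β = α then ((2 * Real.pi) ^ d : ℂ) • b β else 0)
      Measure.count := by
    rw [integrable_count_iff]
    refine summable_of_ne_finset_zero (s := {α}) fun β hβ => ?_
    rw [if_neg (by simpa using hβ), norm_zero]
  rw [integral_countable h4, tsum_eq_single α fun β hβ => by simp [hβ]]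
  rw [if_pos rfl, ← Complex.coe_smul, ← Complex.coe_smul, smul_smul, smul_smul]
  simp

lemma torusCoeff_eq {f : E d → E d} {b : (Fin d → ℤ) → EC d} (hb : Integrable b Measure.count)
    (hf : ∀ x, complexify (f x) = fourierInt Measure.count (latticeHom d) b x) :
    torusCoeff f = b := by
  ext1 α
  rw [torusCoeff, ← setIntegral_cell_fourierInt hb α]
  simp only [hf]

lemma eq_zero_of_fourierInt_torus_eq_zero {h : (Fin d → ℤ) → ℂ} (hh : Integrable h Measure.count)
    (h0 : ∀ x, fourierInt Measure.count (latticeHom d) h x = 0) : h = 0 := by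
  ext1 α
  rw [← setIntegral_cell_fourierInt hh α]
  simp [h0]

lemma expNorm_count {F : Type*} [NormedAddCommGroup F] (b : (Fin d → ℤ) → F) (z : ℝ) :
    expNorm Measure.count (latticeHom d) b z =
      ∑' α : Fin d → ℤ, ENNReal.ofReal (Real.exp (z * ‖latticeVec α‖)) * ‖b α‖ₑ := by
  rw [expNorm, lintegral_count]
  rfl

/-! ### Fourier inversion for periodic functions -/

lemma IsTorusFunction.add_two_pi_smul {F : Type*} {f : E d → F} (hf : IsTorusFunction f) (x : E d)
    (n : Fin d → ℤ) : f (x + (2 * Real.pi) • latticeVec n) = f x := by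
  have h1 : ∀ s : Finset (Fin d), Function.Periodic f
      (∑ j ∈ s, n j • EuclideanSpace.single j (2 * Real.pi)) := by
    intro s
    induction s using Finset.induction_on with
    | empty => intro y; simp
    | insert j s hj ih => rw [Finset.sum_insert hj]; exact ((hf j).zsmul (n j)).add_period ih
  have h2 : (2 * Real.pi) • latticeVec n =
      ∑ j : Fin d, n j • EuclideanSpace.single j (2 * Real.pi) := by
    ext i
    simp [latticeVec, Pi.single_apply, mul_comm]
  rw [h2]
  exact h1 Finset.univ x

lemma mFourier_coe (n : Fin d → ℤ) (y : Fin d → ℝ) :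
    UnitAddTorus.mFourier n (fun i => (y i : UnitAddCircle)) =
      character (latticeVec n) (WithLp.toLp 2 ((2 * Real.pi) • y)) := by
  rw [character_latticeVec]
  change ∏ i, fourier (n i) (y i : UnitAddCircle) = _
  refine Finset.prod_congr rfl fun i _ => ?_
  rw [fourier_coe_apply]
  congr 1
  simp
  ring

/-- The continuous function on the standard torus that corresponds to a periodic function. -/
lemma exists_torus_lift {f : E d → ℂ} (hf : Continuous f) (hp : IsTorusFunction f) :
    ∃ g : C(UnitAddTorus (Fin d), ℂ), ∀ y : Fin d → ℝ,
      g (fun i => (y i : UnitAddCircle)) = f (WithLp.toLp 2 ((2 * Real.pi) • y)) := by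
  -- Openness matters: a product of open quotient maps is again one, whereas a product of general
  -- quotient maps need not be a quotient map.
  have hq : IsOpenQuotientMap (Pi.map fun (_ : Fin d) (t : ℝ) => (t : UnitAddCircle)) :=
    IsOpenQuotientMap.piMap fun _ => QuotientAddGroup.isOpenQuotientMap_mk
  let q : C(Fin d → ℝ, UnitAddTorus (Fin d)) := ⟨_, hq.continuous⟩
  let f' : C(Fin d → ℝ, ℂ) := ⟨fun y => f (WithLp.toLp 2 ((2 * Real.pi) • y)), by fun_prop⟩
  have hq' : Topology.IsQuotientMap q := hq.isQuotientMap
  have hfac : Function.FactorsThrough f' q := by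
    intro y y' h
    have h1 : ∀ i, ∃ n : ℤ, y i = y' i + n := by
      intro i
      have h2 : (y i : UnitAddCircle) = (y' i : UnitAddCircle) := congrFun h i
      rw [QuotientAddGroup.eq_iff_sub_mem, AddSubgroup.mem_zmultiples_iff] at h2
      obtain ⟨n, hn⟩ := h2
      exact ⟨n, by simp at hn; linarith⟩
    choose n hn using h1
    change f _ = f _
    rw [← hp.add_two_pi_smul (WithLp.toLp 2 ((2 * Real.pi) • y')) n]
    congr 1
    ext i
    simp [latticeVec, hn i]
    ring
  refine ⟨hq'.lift f' hfac, fun y => ?_⟩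
  exact congrArg (fun k : C(Fin d → ℝ, ℂ) => k y) (hq'.lift_comp f' hfac)

open scoped Pointwise in
-- The standard torus has period 1, so rescaling by 2π produces the factor (2π)⁻ᵈ. The half-open and
-- the closed box differ by a null set.
lemma mFourierCoeff_lift {f : E d → ℂ} {g : C(UnitAddTorus (Fin d), ℂ)}
    (hg : ∀ y : Fin d → ℝ,
      g (fun i => (y i : UnitAddCircle)) = f (WithLp.toLp 2 ((2 * Real.pi) • y)))
    (α : Fin d → ℤ) :
    UnitAddTorus.mFourierCoeff g α =
      ((2 * Real.pi) ^ d)⁻¹ • ∫ x in cell d, character (-latticeVec α) x • f x := by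
  have hset : {y : Fin d → ℝ | ∀ i, y i ∈ Ioc ((0 : Fin d → ℝ) i) ((0 : Fin d → ℝ) i + 1)} =
      univ.pi fun _ : Fin d => Ioc (0 : ℝ) 1 := by
    ext y; simp
  have hneg : latticeVec (-α) = -latticeVec α := map_neg (latticeHom d) α
  rw [UnitAddTorus.mFourierCoeff_eq_integral g α 0, hset]
  simp only [mFourier_coe, hg, hneg]
  rw [Measure.setIntegral_comp_smul_of_pos volume
    (fun y => character (-latticeVec α) (WithLp.toLp 2 y) • f (WithLp.toLp 2 y)) _
    Real.two_pi_pos, setIntegral_cell]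
  have hs : (2 * Real.pi) • (univ.pi fun _ : Fin d => Ioc (0 : ℝ) 1) =
      univ.pi fun _ : Fin d => Ioc (0 : ℝ) (2 * Real.pi) := by
    rw [smul_set_univ_pi]
    congr 1
    ext1 i
    simp only [Pi.smul_apply]
    rw [← image_smul]
    simp only [smul_eq_mul, image_mul_left_Ioc Real.two_pi_pos, mul_zero, mul_one]
  rw [hs, Module.finrank_fin_fun]
  congr 1
  refine setIntegral_congr_set ?_
  rw [pi_univ_Icc]
  exact Measure.univ_pi_Ioc_ae_eq_Icc

/-- A continuous function on the torus is the sum of its Fourier series if this converges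
absolutely. -/
lemma eq_fourierInt_torusCoeff {f : E d → E d} (hf : Continuous f) (hp : IsTorusFunction f)
    (hs : Integrable (torusCoeff f) Measure.count) (x : E d) :
    complexify (f x) = fourierInt Measure.count (latticeHom d) (torusCoeff f) x := by
  have hφ : Measurable (latticeHom d) := measurable_of_countable _
  ext j
  have hfj : Continuous fun x => complexify (f x) j :=
    (EuclideanSpace.proj j : EC d →L[ℂ] ℂ).continuous.comp (continuous_complexify.comp hf)
  have hpj : IsTorusFunction fun x => complexify (f x) j := fun i y => by
    simp only [hp i y]
  obtain ⟨g, hg⟩ := exists_torus_lift hfj hpj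
  have : IsFiniteMeasure ((volume : Measure (E d)).restrict (cell d)) :=
    ⟨by rw [Measure.restrict_apply_univ]; exact (isCompact_cell d).measure_lt_top⟩
  have hcoef : ∀ α, UnitAddTorus.mFourierCoeff g α = torusCoeff f α j := fun α => by
    rw [mFourierCoeff_lift (f := fun x => complexify (f x) j) hg, torusCoeff]
    have hint : Integrable (fun x => character (-latticeVec α) x • complexify (f x))
        ((volume : Measure (E d)).restrict (cell d)) := by
      have hc : Continuous fun x : E d => character (-latticeVec α) x :=
        continuous_character.comp (by fun_prop : Continuous fun x : E d => (-latticeVec α, x))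
      exact (hc.smul (continuous_complexify.comp hf)).continuousOn.integrableOn_compact
        (isCompact_cell d)
    have h1 := (EuclideanSpace.proj j : EC d →L[ℂ] ℂ).integral_comp_comm hint
    rw [PiLp.smul_apply]
    congr 1
  have hsj : Integrable (fun α => torusCoeff f α j) Measure.count :=
    (EuclideanSpace.proj j : EC d →L[ℂ] ℂ).integrable_comp hs
  have hsum : Summable (UnitAddTorus.mFourierCoeff g) := by
    rw [integrable_count_iff] at hsj
    refine Summable.of_norm ?_
    simpa only [hcoef] using hsj
  have hfin := UnitAddTorus.hasSum_mFourier_series_apply_of_summable hsum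
    (fun i => (((2 * Real.pi)⁻¹ • x.ofLp) i : UnitAddCircle))
  have hx : WithLp.toLp 2 ((2 * Real.pi) • (2 * Real.pi)⁻¹ • x.ofLp) = x := by
    rw [smul_smul, mul_inv_cancel₀ Real.two_pi_pos.ne', one_smul]
  rw [hg, hx] at hfin
  rw [fourierInt_coord hφ hs, fourierInt, integral_countable (integrable_character_smul hφ hsj x),
    ← hfin.tsum_eq]
  refine tsum_congr fun α => ?_
  rw [mFourier_coe, hx, hcoef]
  simp [mul_comm, latticeHom_apply]

/-- Local existence of analytic solutions on the torus. -/
theorem exists_isEulerSolution_torus {ρ : ℝ} (hρ : 0 < ρ) {u₀ : E d → E d}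
    (hdiv : ∀ x, divergence u₀ x = 0) (hu₀ : u₀ ∈ torusX d ρ) :
    ∃ C₁ : ℝ, 0 < C₁ ∧ ∃ (u : ℝ → E d → E d) (p : ℝ → E d → ℝ),
      IsEulerSolution (ρ / C₁) u₀ u p ∧
      ∀ t ∈ Ico 0 (ρ / C₁), u t ∈ torusX d (ρ - C₁ * t) ∧ IsTorusFunction (p t) := by
  obtain ⟨hcont, hper, hgen⟩ := hu₀
  have hφ : Measurable (latticeHom d) := measurable_of_countable _
  have hgen' : expNorm Measure.count (latticeHom d) (torusCoeff u₀) ρ < ∞ := by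
    rw [expNorm_count]; exact hgen
  have hs : Integrable (torusCoeff u₀) Measure.count :=
    integrable_of_expNorm (StronglyMeasurable.of_discrete) hρ.le hgen'
  obtain ⟨a, ha, hagen, hau⟩ := exists_isAmplitude hφ
    (fun h hh h0 => (eq_zero_of_fourierInt_torus_eq_zero hh h0).eventuallyEq) hs
    (eq_fourierInt_torusCoeff hcont hper hs) hdiv hρ hgen'
  obtain ⟨C₁, hC₁, u, p, hsol, hreg, hperiod⟩ := exists_isEulerSolution hφ ha hau hρ hagen
  refine ⟨C₁, hC₁, u, p, hsol, fun t ht => ⟨⟨?_, fun j x => ?_, ?_⟩, fun j x => ?_⟩⟩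
  · exact (hsol.differentiable_velocity t ht).continuous
  · exact (hperiod _ (fun α => character_latticeVec_period α j) t x).1
  · obtain ⟨b, hb, hbgen, hbu⟩ := hreg t ht
    rw [expNorm_count] at hbgen
    -- The amplitudes b are the Fourier coefficients of u(t), so the generator function is their
    -- weighted norm.
    rw [torusGen, torusCoeff_eq hb hbu]
    exact hbgen
  · exact (hperiod _ (fun α => character_latticeVec_period α j) t x).2

end Torus

end EulerAnalytic

end

/-- Local existence of analytic solutions of the incompressible Euler equations on the torus (first
part) and on the whole space (second part). Since `C₁ > 0`, the times `t ≥ 0` at which the radius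
`ρ - C₁ t` is positive are those of `[0, ρ / C₁)`. -/
theorem theorem3p1 (d : ℕ) (hd : 2 ≤ d) (ρ : ℝ) (hρ : 0 < ρ)
    (u₀ : EulerAnalytic.E d → EulerAnalytic.E d)
    (hdiv : ∀ x, EulerAnalytic.divergence u₀ x = 0) :
    (u₀ ∈ EulerAnalytic.torusX d ρ →
      ∃ C₁ : ℝ, 0 < C₁ ∧
        ∃ (u : ℝ → EulerAnalytic.E d → EulerAnalytic.E d) (p : ℝ → EulerAnalytic.E d → ℝ),
          EulerAnalytic.IsEulerSolution (ρ / C₁) u₀ u p ∧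
          ∀ t ∈ Set.Ico 0 (ρ / C₁),
            u t ∈ EulerAnalytic.torusX d (ρ - C₁ * t) ∧ EulerAnalytic.IsTorusFunction (p t)) ∧
    (u₀ ∈ EulerAnalytic.spaceX d ρ →
      ∃ C₁ : ℝ, 0 < C₁ ∧
        ∃ (u : ℝ → EulerAnalytic.E d → EulerAnalytic.E d) (p : ℝ → EulerAnalytic.E d → ℝ),
          EulerAnalytic.IsEulerSolution (ρ / C₁) u₀ u p ∧
          ∀ t ∈ Set.Ico 0 (ρ / C₁), u t ∈ EulerAnalytic.spaceX d (ρ - C₁ * t)) :=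
  ⟨EulerAnalytic.exists_isEulerSolution_torus hρ hdiv,
    EulerAnalytic.exists_isEulerSolution_space hρ hdiv⟩
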